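/- Let $X$ be a compact complex manifold of dimension $n$. Write $A^{p,q}(X)$ for the space of smooth $(p,q)$-forms ($p,q\in\mathbb Z$; zero if $p<0$ or $q<0$) and $A^{0,q}(X,T^{1,0})$ for the space of smooth $(0,q)$-forms with values in the holomorphic tangent bundle. Put $F^pA^k=\bigoplus_{l\ge p}A^{l,k-l}(X)$ and let $(E_r^{p,q},d_r^{p,q})$ be the Frölicher spectral sequence of $X$: $$Z_r^{p,q}=F^pA^{p+q}\cap d^{-1}(F^{p+r}A^{p+q+1}),\qquad B_r^{p,q}=F^pA^{p+q}\cap d(F^{p-r}A^{p+q-1}),$$ $$E_r^{p,q}=Z_r^{p,q}/(Z_{r-1}^{p+1,q-1}+B_{r-1}^{p,q}),\qquad d_r^{p,q}\colon E_r^{p,q}\to E_r^{p+r,q-r+1}\ \text{ induced by } d.$$ For $\varphi=\sum_j\varphi^j\otimes\partial/\partial z^j$ and $\psi=\sum_j\psi^j\otimes\partial/\partial z^j$ in $A^{0,1}(X,T^{1,0})$ let $$[\varphi,\psi]=\sum_{i,j}\bigl(\varphi^i\wedge\partial_i\psi^j+\psi^i\wedge\partial_i\varphi^j\bigr)\otimes\frac{\partial}{\partial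 z^j}\in A^{0,2}(X,T^{1,0}),$$ where $\partial_i=\partial/\partial z^i$ acts on the coefficients with respect to the $d\bar z^k$. For $\sigma=\sum_j\sigma^j\otimes\partial/\partial z^j\in A^{0,2}(X,T^{1,0})$ let $i_\sigma\alpha=\sum_j\sigma^j\wedge(\partial/\partial z^j\,\lrcorner\,\alpha)$, and let $$\mu_{p,q}\colon H^{0,2}_{\bar\partial}(X,T^{1,0})\to\operatorname{Hom}\bigl(H^{p,q}_{\bar\partial}(X),H^{p-1,q+2}_{\bar\partial}(X)\bigr),\qquad[\sigma]\mapsto\bigl([\alpha]\mapsto[i_\sigma\alpha]\bigr).$$ **Theorem.** Let $p,q\in\mathbb Z$ be such that $$d_r^{p,q}=0\quad\text{and}\quad d_r^{p-1,q+1}=0\quad\text{for all } r\ge1,\qquad d_r^{p-2-i,\,q+2+i}=0\quad\text{for all } r\ge1 \text{ and } 0\le i\le r-1.$$ Let $N\ge0$ and let $\varphi_1,\dots,\varphi_N\in A^{0,1}(X,T^{1,0})$ be a deformation of order $N$, that is, $$\bar\partial\varphi_k=\tfrac12\sum_{j=1}^{k-1}[\varphi_j,\varphi_{k-j}]\qquad(1\le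 k\le N).$$ Then the obstruction $\sum_{j=1}^N[\varphi_j,\varphi_{N+1-j}]$ is $\bar\partial$-closed, and its class in $H^{0,2}_{\bar\partial}(X,T^{1,0})$ lies in $\ker\mu_{p,q}$. -/

import Mathlib

open scoped Manifold ContDiff

noncomputable section

set_option linter.unusedSectionVars false
set_option linter.unnecessarySeqFocus false

namespace Frolicher

/-! ### Forms at a point of `ℂⁿ` -/

/-- Indices of the coordinate coframe: `Sum.inl i` stands for `dzⁱ`, `Sum.inr i` for `dz̄ⁱ`. -/
abbrev Ix (n : ℕ) := Fin n ⊕ Fin n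

/-- The exterior algebra over `ℂ` on the coframe `dz¹,…,dzⁿ,dz̄¹,…,dz̄ⁿ`. -/
abbrev Lam (n : ℕ) := ExteriorAlgebra ℂ (Ix n → ℂ)

instance (n : ℕ) : Module.Finite ℂ (Lam n) := by
  let _ : LinearOrder (Ix n) := inferInstanceAs (LinearOrder (Fin n ⊕ₗ Fin n))
  exact Module.Finite.of_basis (Pi.basisFun ℂ (Ix n)).ExteriorAlgebra

/-- A norm on the finite-dimensional space `Lam n` (all choices are equivalent); it is only used to
speak of smooth functions with values in `Lam n` and of their derivatives. -/
instance (n : ℕ) : NormedAddCommGroup (Lam n) :=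
  NormedAddCommGroup.induced (Lam n) (Fin (Module.finrank ℂ (Lam n)) → ℂ)
    (Module.finBasis ℂ (Lam n)).equivFun.toLinearMap (Module.finBasis ℂ (Lam n)).equivFun.injective

instance (n : ℕ) : NormedSpace ℂ (Lam n) :=
  NormedSpace.induced ℂ (Lam n) (Fin (Module.finrank ℂ (Lam n)) → ℂ)
    (Module.finBasis ℂ (Lam n)).equivFun.toLinearMap

variable {n : ℕ}

/-- The covector `dzⁱ` (for `a = Sum.inl i`) or `dz̄ⁱ` (for `a = Sum.inr i`). -/
def cov (a : Ix n) : Lam n := ExteriorAlgebra.ι ℂ (Pi.single a 1)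

/-- The span of the `dzⁱ`. -/
def V10 (n : ℕ) : Submodule ℂ (Lam n) := Submodule.span ℂ (Set.range fun i => cov (Sum.inl i))

/-- The span of the `dz̄ⁱ`. -/
def V01 (n : ℕ) : Submodule ℂ (Lam n) := Submodule.span ℂ (Set.range fun i => cov (Sum.inr i))

/-- Covectors of type `(p,q)`: linear combinations of products of `p` of the `dzⁱ` and `q` of the
`dz̄ⁱ`; zero if `p < 0` or `q < 0`. -/
def bideg (n : ℕ) (p q : ℤ) : Submodule ℂ (Lam n) :=
  if 0 ≤ p ∧ 0 ≤ q then V10 n ^ p.toNat * V01 n ^ q.toNat else ⊥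

/-- The contraction `∂/∂zⁱ ⌟ λ`. -/
def contr (i : Fin n) : Lam n →ₗ[ℂ] Lam n :=
  CliffordAlgebra.contractLeft (LinearMap.proj (Sum.inl i))

/-- The cotangent map of a complex linear map `L`, on the complexified cotangent space:
`dzʲ ↦ ∑ᵢ Lʲᵢ dzⁱ` and `dz̄ʲ ↦ ∑ᵢ conj Lʲᵢ dz̄ⁱ`. -/
def cotan (L : (Fin n → ℂ) →L[ℂ] (Fin n → ℂ)) : (Ix n → ℂ) →ₗ[ℂ] (Ix n → ℂ) where
  toFun w := Sum.elim
    (fun i => ∑ j, w (Sum.inl j) * L (Pi.single i 1) j)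
    (fun i => ∑ j, w (Sum.inr j) * (starRingEnd ℂ) (L (Pi.single i 1) j))
  map_add' v w := by
    ext a; rcases a with i | i <;> simp [add_mul, Finset.sum_add_distrib]
  map_smul' c w := by
    ext a; rcases a with i | i <;> simp [Finset.mul_sum, mul_assoc]

/-- Pull-back of covectors along a complex linear map. -/
def pull (L : (Fin n → ℂ) →L[ℂ] (Fin n → ℂ)) : Lam n →ₐ[ℂ] Lam n :=
  ExteriorAlgebra.map (cotan L)

/-! ### Calculus in a chart -/

/-- The Wirtinger derivatives: `∂f/∂zⁱ = ½ (∂f/∂xⁱ - i ∂f/∂yⁱ)` for `Sum.inl i` and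
`∂f/∂z̄ⁱ = ½ (∂f/∂xⁱ + i ∂f/∂yⁱ)` for `Sum.inr i`. -/
def wirt {V : Type*} [NormedAddCommGroup V] [NormedSpace ℂ V] :
    Ix n → ((Fin n → ℂ) → V) → (Fin n → ℂ) → V
  | Sum.inl i, f, z => (1 / 2 : ℂ) • (fderiv ℝ f z (Pi.single i 1)
      - Complex.I • fderiv ℝ f z (Pi.single i Complex.I))
  | Sum.inr i, f, z => (1 / 2 : ℂ) • (fderiv ℝ f z (Pi.single i 1)
      + Complex.I • fderiv ℝ f z (Pi.single i Complex.I))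

/-- `∑ₖ dx^{g k} ∧ ∂f/∂x^{g k}`; it is `∂f` for `g = Sum.inl` and `∂̄f` for `g = Sum.inr`. -/
def dAlong {κ : Type*} [Fintype κ] (g : κ → Ix n) (f : (Fin n → ℂ) → Lam n) (z : Fin n → ℂ) :
    Lam n := ∑ k, cov (g k) * wirt (g k) f z

/-- `i_φ λ = ∑ᵢ φⁱ ∧ (∂/∂zⁱ ⌟ λ)`, for the vector-valued covector `φ = ∑ᵢ φⁱ ⊗ ∂/∂zⁱ`. -/
def contrLoc (φ : Fin n → Lam n) (l : Lam n) : Lam n := ∑ i, φ i * contr i l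

/-- The coefficient of `∂/∂zʲ` in `[φ,ψ]`, for `φ` and `ψ` of type `(0,1)`:
`∑ᵢ (φⁱ ∧ ∂ᵢψʲ + ψⁱ ∧ ∂ᵢφʲ)`, where `∂ᵢ = ∂/∂zⁱ` acts on the coefficients with respect to the
`dz̄ᵏ`. -/
def bracketLoc (φ ψ : (Fin n → ℂ) → Fin n → Lam n) (z : Fin n → ℂ) (j : Fin n) : Lam n :=
  ∑ i, (φ z i * wirt (Sum.inl i) (fun w => ψ w j) z + ψ z i * wirt (Sum.inl i) (fun w => φ w j) z)

/-! ### Facts about covectors -/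

lemma cov_mul_cov (a b : Ix n) : cov a * cov b = -(cov b * cov a) :=
  eq_neg_of_add_eq_zero_left (ExteriorAlgebra.ι_add_mul_swap _ _)

lemma contr_cov_mul (i : Fin n) (a : Ix n) (l : Lam n) :
    contr i (cov a * l) = (if a = Sum.inl i then l else 0) - cov a * contr i l := by
  unfold contr cov ExteriorAlgebra.ι
  rw [CliffordAlgebra.contractLeft_ι_mul]
  by_cases h : a = Sum.inl i
  · subst h; simp
  · simp [h, Ne.symm h]

lemma pull_ι (L : (Fin n → ℂ) →L[ℂ] (Fin n → ℂ)) (w : Ix n → ℂ) :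
    pull L (ExteriorAlgebra.ι ℂ w) = ExteriorAlgebra.ι ℂ (cotan L w) :=
  ExteriorAlgebra.map_apply_ι _ _

lemma ι_eq_sum (w : Ix n → ℂ) : ExteriorAlgebra.ι ℂ w = ∑ a, w a • cov a := by
  conv_lhs => rw [← Finset.univ_sum_single w]
  rw [map_sum]
  refine Finset.sum_congr rfl fun a _ => ?_
  rw [cov, ← map_smul, ← Pi.single_smul, smul_eq_mul, mul_one]

lemma pull_cov_inl (L : (Fin n → ℂ) →L[ℂ] (Fin n → ℂ)) (j : Fin n) :
    pull L (cov (Sum.inl j)) = ∑ i, L (Pi.single i 1) j • cov (Sum.inl i) := by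
  rw [cov, pull_ι, ι_eq_sum, Fintype.sum_sum_type]
  simp [cotan, Pi.single_apply]

lemma pull_cov_inr (L : (Fin n → ℂ) →L[ℂ] (Fin n → ℂ)) (j : Fin n) :
    pull L (cov (Sum.inr j))
      = ∑ i, (starRingEnd ℂ) (L (Pi.single i 1) j) • cov (Sum.inr i) := by
  rw [cov, pull_ι, ι_eq_sum, Fintype.sum_sum_type]
  simp [cotan, Pi.single_apply]

lemma lam_induction {P : Lam n → Prop} (one : P 1) (smul : ∀ (c : ℂ) x, P x → P (c • x))
    (add : ∀ x y, P x → P y → P (x + y)) (mul : ∀ a x, P x → P (cov a * x)) (x : Lam n) : P x := by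
  have zero : P 0 := by simpa using smul 0 1 one
  induction x using CliffordAlgebra.left_induction with
  | algebraMap r => rw [Algebra.algebraMap_eq_smul_one]; exact smul r 1 one
  | add x y hx hy => exact add x y hx hy
  | ι_mul x m hx =>
    change P (ExteriorAlgebra.ι ℂ m * x)
    rw [ι_eq_sum, Finset.sum_mul]
    refine Finset.sum_induction _ P add zero fun a _ => ?_
    rw [smul_mul_assoc]
    exact smul _ _ (mul a x hx)

lemma contr_one (i : Fin n) : contr i (1 : Lam n) = 0 := by
  unfold contr
  exact CliffordAlgebra.contractLeft_one (Q := (0 : QuadraticForm ℂ (Ix n → ℂ))) _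

lemma contr_pull (L : (Fin n → ℂ) →L[ℂ] (Fin n → ℂ)) (i : Fin n) (l : Lam n) :
    contr i (pull L l) = ∑ j, L (Pi.single i 1) j • pull L (contr j l) := by
  induction l using lam_induction with
  | one => simp [contr_one]
  | smul c x hx => simp [hx, Finset.smul_sum, smul_comm c]
  | add x y hx hy => simp [hx, hy, Finset.sum_add_distrib]
  | mul a x hx =>
    simp only [map_mul, contr_cov_mul, map_sub, smul_sub, Finset.sum_sub_distrib]
    rcases a with k | k
    · rw [pull_cov_inl, Finset.sum_mul]
      simp only [smul_mul_assoc, map_sum, map_smul, contr_cov_mul, hx, smul_sub,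
        Finset.sum_sub_distrib, Finset.sum_mul, Finset.mul_sum, mul_smul_comm]
      congr 1
      · simp [apply_ite (pull L)]
      · simp only [Finset.smul_sum]
        rw [Finset.sum_comm]
        exact Finset.sum_congr rfl fun _ _ => Finset.sum_congr rfl fun _ _ => smul_comm _ _ _
    · rw [pull_cov_inr, Finset.sum_mul]
      simp only [smul_mul_assoc, map_sum, map_smul, contr_cov_mul, hx, smul_sub,
        Finset.sum_sub_distrib, Finset.sum_mul, Finset.mul_sum, mul_smul_comm]
      congr 1
      · simp
      · simp only [Finset.smul_sum]
        rw [Finset.sum_comm]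
        exact Finset.sum_congr rfl fun _ _ => Finset.sum_congr rfl fun _ _ => smul_comm _ _ _

/-- The contraction of a form with a vector-valued form does not depend on the coordinates. -/
lemma contrLoc_pull (L : (Fin n → ℂ) →L[ℂ] (Fin n → ℂ)) (φ φ' : Fin n → Lam n) (l : Lam n)
    (h : ∀ j, pull L (φ' j) = ∑ i, L (Pi.single i 1) j • φ i) :
    pull L (contrLoc φ' l) = contrLoc φ (pull L l) := by
  simp only [contrLoc, map_sum, map_mul, h, contr_pull, Finset.sum_mul, Finset.mul_sum,
    smul_mul_assoc, mul_smul_comm]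
  exact Finset.sum_comm

lemma bideg_natCast (a b : ℕ) : bideg n a b = V10 n ^ a * V01 n ^ b := by
  simp [bideg]

lemma bideg_of_neg {p q : ℤ} (h : ¬ (0 ≤ p ∧ 0 ≤ q)) : bideg n p q = ⊥ := by
  simp only [bideg, if_neg h]

lemma bideg_zero_natCast (q : ℕ) : bideg n 0 q = V01 n ^ q := by
  simpa using bideg_natCast (n := n) 0 q

lemma V01_mul_V10 : V01 n * V10 n = V10 n * V01 n := by
  simp only [V01, V10, Submodule.span_mul_span]
  apply le_antisymm <;> rw [Submodule.span_le] <;> rintro _ ⟨_, ⟨i, rfl⟩, _, ⟨j, rfl⟩, rfl⟩ <;>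
    simp only [SetLike.mem_coe] <;> rw [cov_mul_cov] <;>
    exact Submodule.neg_mem _ (Submodule.subset_span ⟨_, ⟨j, rfl⟩, _, ⟨i, rfl⟩, rfl⟩)

lemma cov_mul_of_mem (a : Ix n) (q : ℕ) {x : Lam n} (hx : x ∈ V01 n ^ q) :
    cov a * x = (-1 : ℂ) ^ q • (x * cov a) := by
  induction q generalizing x with
  | zero =>
    rw [pow_zero, Submodule.mem_one] at hx
    obtain ⟨c, rfl⟩ := hx
    simp [Algebra.commutes]
  | succ q ih =>
    rw [pow_succ'] at hx
    induction hx using Submodule.mul_induction_on' with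
    | add x _ y _ hx hy => simp [mul_add, add_mul, hx, hy]
    | mem_mul_mem u hu v hv =>
      have h1 : cov a * u = -(u * cov a) := by
        induction hu using Submodule.span_induction with
        | mem x hx => obtain ⟨i, rfl⟩ := hx; exact cov_mul_cov _ _
        | zero => simp
        | add x y _ _ hx hy => rw [mul_add, add_mul, hx, hy]; abel
        | smul c x _ hx => simp [hx]
      rw [← mul_assoc, h1, neg_mul, mul_assoc, ih hv, pow_succ, mul_smul_comm, mul_assoc]
      simp

lemma contr_V01 (i : Fin n) (b : ℕ) {x : Lam n} (hx : x ∈ V01 n ^ b) : contr i x = 0 := by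
  induction b generalizing x with
  | zero =>
    rw [pow_zero, Submodule.mem_one] at hx
    obtain ⟨c, rfl⟩ := hx
    rw [Algebra.algebraMap_eq_smul_one, map_smul, contr_one, smul_zero]
  | succ b ih =>
    rw [pow_succ'] at hx
    induction hx using Submodule.mul_induction_on' with
    | add x _ y _ hx hy => rw [map_add, hx, hy, add_zero]
    | mem_mul_mem u hu v hv =>
      induction hu using Submodule.span_induction with
      | mem x hx => obtain ⟨j, rfl⟩ := hx; simp [contr_cov_mul, ih hv]
      | zero => simp
      | add x y _ _ hx hy => rw [add_mul, map_add, hx, hy, add_zero]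
      | smul c x _ hx => rw [smul_mul_assoc, map_smul, hx, smul_zero]

lemma contr_mem (i : Fin n) (a b : ℕ) {x : Lam n} (hx : x ∈ V10 n ^ (a + 1) * V01 n ^ b) :
    contr i x ∈ V10 n ^ a * V01 n ^ b := by
  induction a generalizing x with
  | zero =>
    rw [zero_add, pow_one] at hx
    rw [pow_zero, one_mul]
    induction hx using Submodule.mul_induction_on' with
    | add x _ y _ hx hy => rw [map_add]; exact add_mem hx hy
    | mem_mul_mem u hu v hv =>
      induction hu using Submodule.span_induction with
      | mem x hx =>
        obtain ⟨j, rfl⟩ := hx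
        simp only [contr_cov_mul, contr_V01 i b hv, mul_zero, sub_zero]
        split_ifs
        exacts [hv, zero_mem _]
      | zero => simp
      | add x y _ _ hx hy => rw [add_mul, map_add]; exact add_mem hx hy
      | smul c x _ hx => rw [smul_mul_assoc, map_smul]; exact Submodule.smul_mem _ _ hx
  | succ a ih =>
    rw [pow_succ', mul_assoc] at hx
    induction hx using Submodule.mul_induction_on' with
    | add x _ y _ hx hy => rw [map_add]; exact add_mem hx hy
    | mem_mul_mem u hu v hv =>
      induction hu using Submodule.span_induction with
      | mem x hx =>
        obtain ⟨j, rfl⟩ := hx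
        simp only [contr_cov_mul]
        refine sub_mem ?_ ?_
        · split_ifs
          exacts [hv, zero_mem _]
        · rw [pow_succ', mul_assoc]
          exact Submodule.mul_mem_mul (Submodule.subset_span ⟨j, rfl⟩) (ih hv)
      | zero => simp
      | add x y _ _ hx hy => rw [add_mul, map_add]; exact add_mem hx hy
      | smul c x _ hx => rw [smul_mul_assoc, map_smul]; exact Submodule.smul_mem _ _ hx

/-- Contraction with a vector-valued form of type `(0,r)` has bidegree `(-1,r)`. -/
lemma contrLoc_mem {p q : ℤ} {r : ℕ} {φ : Fin n → Lam n} (hφ : ∀ i, φ i ∈ bideg n 0 r) {l : Lam n}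
    (hl : l ∈ bideg n p q) : contrLoc φ l ∈ bideg n (p - 1) (q + r) := by
  by_cases h : 0 ≤ p ∧ 0 ≤ q
  · obtain ⟨⟨a, rfl⟩, ⟨b, rfl⟩⟩ := And.imp Int.eq_ofNat_of_zero_le Int.eq_ofNat_of_zero_le h
    rw [bideg_natCast] at hl
    simp only [bideg_zero_natCast] at hφ
    refine Submodule.sum_mem _ fun i _ => ?_
    rcases a with _ | a
    · rw [pow_zero, one_mul] at hl
      rw [contr_V01 i b hl, mul_zero]
      exact zero_mem _
    · have : bideg n (((a + 1 : ℕ) : ℤ) - 1) (b + r) = V01 n ^ r * (V10 n ^ a * V01 n ^ b) := by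
        have h1 := bideg_natCast (n := n) a (b + r)
        push_cast at h1 ⊢
        rw [add_sub_cancel_right, h1, ← mul_assoc,
          ((show Commute (V01 n) (V10 n) from V01_mul_V10).pow_pow r a).eq, mul_assoc, ← pow_add,
          add_comm r b]
      rw [this]
      exact Submodule.mul_mem_mul (hφ i) (contr_mem i a b hl)
  · rw [bideg_of_neg h, Submodule.mem_bot] at hl
    subst hl
    simp [contrLoc]

/-! ### Facts about Wirtinger derivatives -/

section Calculus

variable {V V' : Type*} [NormedAddCommGroup V] [NormedSpace ℂ V] [NormedAddCommGroup V']
  [NormedSpace ℂ V'] {f g : (Fin n → ℂ) → V} {z : Fin n → ℂ}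

open Filter Topology

lemma wirt_congr (a : Ix n) (h : f =ᶠ[𝓝 z] g) : wirt a f z = wirt a g z := by
  rcases a with i | i <;> simp only [wirt, h.fderiv_eq]

lemma wirt_add (a : Ix n) (hf : DifferentiableAt ℝ f z) (hg : DifferentiableAt ℝ g z) :
    wirt a (fun w => f w + g w) z = wirt a f z + wirt a g z := by
  rcases a with i | i <;> simp only [wirt, fderiv_fun_add hf hg, add_apply] <;> module

lemma wirt_clm (a : Ix n) (T : V →ₗ[ℂ] V') [FiniteDimensional ℂ V]
    (hf : DifferentiableAt ℝ f z) : wirt a (fun w => T (f w)) z = T (wirt a f z) := by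
  let T' : V →L[ℝ] V' := (LinearMap.toContinuousLinearMap T).restrictScalars ℝ
  have h : fderiv ℝ (fun w => T (f w)) z = T' ∘L fderiv ℝ f z :=
    (T'.hasFDerivAt.comp z hf.hasFDerivAt).fderiv
  rcases a with i | i <;> simp only [wirt, h] <;> simp [T']

lemma wirt_bilin {V'' : Type*} [NormedAddCommGroup V''] [NormedSpace ℂ V'']
    [FiniteDimensional ℂ V] [FiniteDimensional ℂ V'] (B : V →ₗ[ℂ] V' →ₗ[ℂ] V'') (a : Ix n)
    {g : (Fin n → ℂ) → V'} (hf : DifferentiableAt ℝ f z) (hg : DifferentiableAt ℝ g z) :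
    DifferentiableAt ℝ (fun w => B (f w) (g w)) z ∧
    wirt a (fun w => B (f w) (g w)) z = B (wirt a f z) (g z) + B (f z) (wirt a g z) := by
  let B' : V →L[ℝ] V' →L[ℝ] V'' :=
    (ContinuousLinearMap.restrictScalarsL ℂ V' V'' ℝ ℝ) ∘L
      ((LinearMap.toContinuousBilinearMap B).restrictScalars ℝ)
  have h := B'.hasFDerivAt_of_bilinear hf.hasFDerivAt hg.hasFDerivAt
  have h' : fderiv ℝ (fun w => B (f w) (g w)) z = _ := h.fderiv
  refine ⟨h.differentiableAt, ?_⟩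
  rcases a with i | i <;> simp only [wirt, h'] <;> simp [B'] <;> module

lemma wirt_smul_fun (a : Ix n) {u : (Fin n → ℂ) → ℂ} [FiniteDimensional ℂ V]
    (hu : DifferentiableAt ℝ u z) (hf : DifferentiableAt ℝ f z) :
    wirt a (fun w => u w • f w) z = wirt a u z • f z + u z • wirt a f z :=
  (wirt_bilin (LinearMap.lsmul ℂ V) a hu hf).2

lemma wirt_mul (a : Ix n) {f g : (Fin n → ℂ) → Lam n} (hf : DifferentiableAt ℝ f z)
    (hg : DifferentiableAt ℝ g z) : DifferentiableAt ℝ (fun w => f w * g w) z ∧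
    wirt a (fun w => f w * g w) z = wirt a f z * g z + f z * wirt a g z :=
  wirt_bilin (LinearMap.mul ℂ (Lam n)) a hf hg

lemma wirt_const (a : Ix n) (c : V) : wirt a (fun _ => c) z = 0 := by
  rcases a with i | i <;> simp [wirt]

lemma wirt_sum (a : Ix n) {κ : Type*} (s : Finset κ) {f : κ → (Fin n → ℂ) → V}
    (hf : ∀ k ∈ s, DifferentiableAt ℝ (f k) z) :
    wirt a (fun w => ∑ k ∈ s, f k w) z = ∑ k ∈ s, wirt a (f k) z := by
  have h := fderiv_fun_sum (𝕜 := ℝ) hf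
  rcases a with i | i <;>
    simp only [wirt, h, sum_apply, Finset.smul_sum, smul_sub, smul_add,
      Finset.sum_sub_distrib, Finset.sum_add_distrib]

/-- Derivatives of a function with values in a subspace lie in that subspace. -/
lemma wirt_mem (a : Ix n) (S : Submodule ℂ V) [FiniteDimensional ℂ V]
    (hf : DifferentiableAt ℝ f z) (h : ∀ᶠ w in 𝓝 z, f w ∈ S) : wirt a f z ∈ S := by
  obtain ⟨T, hT⟩ := S.exists_isCompl
  have hk := Submodule.ker_projectionOnto hT.symm
  rw [← hk, LinearMap.mem_ker, ← Submodule.coe_eq_zero]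
  have := wirt_clm (f := f) a (T.subtype ∘ₗ T.projectionOnto S hT.symm) hf
  rw [wirt_congr (g := fun _ => 0) a, wirt_const] at this
  · exact this.symm
  · filter_upwards [h] with w hw
    rw [← hk] at hw
    simp [LinearMap.mem_ker.1 hw]

lemma contDiffOn_wirt (a : Ix n) {U : Set (Fin n → ℂ)} (hU : IsOpen U)
    (hf : ContDiffOn ℝ ∞ f U) : ContDiffOn ℝ ∞ (wirt a f) U := by
  have h := hf.fderiv_of_isOpen (m := ∞) hU (by simp)
  rcases a with i | i
  · exact contDiffOn_const.smul ((h.clm_apply contDiffOn_const).sub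
      (contDiffOn_const.smul (h.clm_apply contDiffOn_const)))
  · exact contDiffOn_const.smul ((h.clm_apply contDiffOn_const).add
      (contDiffOn_const.smul (h.clm_apply contDiffOn_const)))

lemma contDiffOn_mul {U : Set (Fin n → ℂ)} {f g : (Fin n → ℂ) → Lam n}
    (hf : ContDiffOn ℝ ∞ f U) (hg : ContDiffOn ℝ ∞ g U) :
    ContDiffOn ℝ ∞ (fun w => f w * g w) U := by
  let B' : Lam n →L[ℝ] Lam n →L[ℝ] Lam n :=
    (ContinuousLinearMap.restrictScalarsL ℂ (Lam n) (Lam n) ℝ ℝ) ∘L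
      ((LinearMap.toContinuousBilinearMap (LinearMap.mul ℂ (Lam n))).restrictScalars ℝ)
  exact B'.isBoundedBilinearMap.contDiff.comp_contDiffOn (hf.prodMk hg)

lemma contDiffOn_clm {U : Set (Fin n → ℂ)} [FiniteDimensional ℂ V] (T : V →ₗ[ℂ] V')
    (hf : ContDiffOn ℝ ∞ f U) : ContDiffOn ℝ ∞ (fun w => T (f w)) U :=
  ((LinearMap.toContinuousLinearMap T).restrictScalars ℝ).contDiff.comp_contDiffOn hf

lemma differentiableAt_clm [FiniteDimensional ℂ V] (T : V →ₗ[ℂ] V')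
    (hf : DifferentiableAt ℝ f z) : DifferentiableAt ℝ (fun w => T (f w)) z :=
  ((LinearMap.toContinuousLinearMap T).restrictScalars ℝ).differentiableAt.comp z hf

lemma wirt_comm (a b : Ix n) (hf : ContDiffAt ℝ ∞ f z) :
    wirt a (wirt b f) z = wirt b (wirt a f) z := by
  have hs : IsSymmSndFDerivAt ℝ f z := hf.isSymmSndFDerivAt (by simpa using (by norm_cast : (2 : ℕ∞ω) ≤ ∞))
  have hd : DifferentiableAt ℝ (fderiv ℝ f) z :=
    (hf.fderiv_right (m := 1) (by norm_cast)).differentiableAt (by simp)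
  have h1 : ∀ v w, fderiv ℝ (fun y => fderiv ℝ f y v) z w = fderiv ℝ (fderiv ℝ f) z w v := by
    intro v w
    rw [fderiv_clm_apply hd (differentiableAt_const v)]
    simp
  have h2 : ∀ v, DifferentiableAt ℝ (fun y => fderiv ℝ f y v) z := fun v =>
    hd.clm_apply (differentiableAt_const v)
  have h3 : ∀ v (c : ℂ), DifferentiableAt ℝ (fun y => c • fderiv ℝ f y v) z := fun v c =>
    (h2 v).const_smul c
  have key : ∀ b v, fderiv ℝ (wirt b f) z v
      = wirt b (fun y => fderiv ℝ f y v) z := by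
    intro b v
    rcases b with i | i
    · have : wirt (Sum.inl i) f = fun y => (1 / 2 : ℂ) • (fderiv ℝ f y (Pi.single i 1)
          - Complex.I • fderiv ℝ f y (Pi.single i Complex.I)) := rfl
      rw [this, fderiv_fun_const_smul ((h2 _).fun_sub (h3 _ _)), fderiv_fun_sub (h2 _) (h3 _ _),
        fderiv_fun_const_smul (h2 _)]
      simp only [wirt, h1, smul_apply, sub_apply]
      rw [hs.eq, hs.eq v]
    · have : wirt (Sum.inr i) f = fun y => (1 / 2 : ℂ) • (fderiv ℝ f y (Pi.single i 1)
          + Complex.I • fderiv ℝ f y (Pi.single i Complex.I)) := rfl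
      rw [this, fderiv_fun_const_smul ((h2 _).fun_add (h3 _ _)), fderiv_fun_add (h2 _) (h3 _ _),
        fderiv_fun_const_smul (h2 _)]
      simp only [wirt, h1, smul_apply, add_apply]
      rw [hs.eq, hs.eq v]
  rcases a with i | i <;> rcases b with j | j <;>
    simp only [wirt, key, h1] <;> simp only [hs.eq] <;> module

lemma wirt_inl_holo {u : (Fin n → ℂ) → V} (hu : DifferentiableAt ℂ u z) (i : Fin n) :
    wirt (Sum.inl i) u z = fderiv ℂ u z (Pi.single i 1) := by
  have h : (Pi.single i Complex.I : Fin n → ℂ) = Complex.I • Pi.single i 1 := by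
    rw [← Pi.single_smul]; simp
  simp only [wirt, hu.fderiv_restrictScalars ℝ, ContinuousLinearMap.coe_restrictScalars', h,
    map_smul, smul_smul, Complex.I_mul_I]
  module

lemma wirt_inr_holo {u : (Fin n → ℂ) → V} (hu : DifferentiableAt ℂ u z) (i : Fin n) :
    wirt (Sum.inr i) u z = 0 := by
  have h : (Pi.single i Complex.I : Fin n → ℂ) = Complex.I • Pi.single i 1 := by
    rw [← Pi.single_smul]; simp
  simp only [wirt, hu.fderiv_restrictScalars ℝ, ContinuousLinearMap.coe_restrictScalars', h,
    map_smul, smul_smul, Complex.I_mul_I]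
  module

lemma wirt_conj {u : (Fin n → ℂ) → ℂ} (hu : DifferentiableAt ℝ u z) (a : Ix n) :
    DifferentiableAt ℝ (fun w => (starRingEnd ℂ) (u w)) z ∧
    wirt a (fun w => (starRingEnd ℂ) (u w)) z = (starRingEnd ℂ) (wirt a.swap u z) := by
  have h1 := (Complex.conjCLE : ℂ →L[ℝ] ℂ).hasFDerivAt.comp z hu.hasFDerivAt
  have h : fderiv ℝ (fun w => (starRingEnd ℂ) (u w)) z = _ := h1.fderiv
  refine ⟨h1.differentiableAt, ?_⟩
  rcases a with i | i <;> simp only [wirt, h, Sum.swap_inl, Sum.swap_inr] <;>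
    simp [show (starRingEnd ℂ) 2 = 2 from Complex.conj_ofNat 2] <;> ring

end Calculus

/-! ### Behaviour under holomorphic changes of coordinates -/

section Naturality

open Filter Topology

variable {F : (Fin n → ℂ) → (Fin n → ℂ)} {z : Fin n → ℂ}

lemma real_linear_expand {V : Type*} [NormedAddCommGroup V] [NormedSpace ℂ V]
    (T : (Fin n → ℂ) →L[ℝ] V) (c : Fin n → ℂ) :
    T c = ∑ j, ((c j).re • T (Pi.single j 1) + (c j).im • T (Pi.single j Complex.I)) := by
  conv_lhs => rw [← Finset.univ_sum_single c]
  rw [map_sum]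
  refine Finset.sum_congr rfl fun j _ => ?_
  rw [← map_smul, ← map_smul, ← map_add, ← Pi.single_smul, ← Pi.single_smul, ← Pi.single_add]
  congr 2
  simp [Complex.re_add_im]

lemma wirt_comp {V : Type*} [NormedAddCommGroup V] [NormedSpace ℂ V] {f : (Fin n → ℂ) → V}
    (hF : DifferentiableAt ℂ F z) (hf : DifferentiableAt ℝ f (F z)) (i : Fin n) :
    wirt (Sum.inl i) (fun w => f (F w)) z
      = ∑ j, fderiv ℂ F z (Pi.single i 1) j • wirt (Sum.inl j) f (F z) ∧
    wirt (Sum.inr i) (fun w => f (F w)) z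
      = ∑ j, (starRingEnd ℂ) (fderiv ℂ F z (Pi.single i 1) j) • wirt (Sum.inr j) f (F z) := by
  have hF' : HasFDerivAt F ((fderiv ℂ F z).restrictScalars ℝ) z :=
    hF.hasFDerivAt.restrictScalars ℝ
  have h : fderiv ℝ (fun w => f (F w)) z
      = (fderiv ℝ f (F z)) ∘L ((fderiv ℂ F z).restrictScalars ℝ) :=
    (hf.hasFDerivAt.comp z hF').fderiv
  have hI : (Pi.single i Complex.I : Fin n → ℂ) = Complex.I • Pi.single i 1 := by
    rw [← Pi.single_smul]; simp
  have e : ∀ v, fderiv ℝ (fun w => f (F w)) z v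
      = ∑ j, ((fderiv ℂ F z v j).re • fderiv ℝ f (F z) (Pi.single j 1)
        + (fderiv ℂ F z v j).im • fderiv ℝ f (F z) (Pi.single j Complex.I)) := by
    intro v
    rw [h, ContinuousLinearMap.comp_apply, real_linear_expand]
    rfl
  constructor <;> simp only [wirt, e, hI, map_smul, Finset.smul_sum] <;>
    first | rw [← Finset.sum_sub_distrib] | rw [← Finset.sum_add_distrib]
  all_goals
    rw [Finset.smul_sum]
    refine Finset.sum_congr rfl fun j _ => ?_
    generalize fderiv ℂ F z (Pi.single i 1) = c
    simp only [Pi.smul_apply, smul_eq_mul, Complex.mul_re, Complex.mul_im, Complex.I_re,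
      Complex.I_im, zero_mul, one_mul, zero_sub, zero_add, ← Complex.coe_smul (E := V)]
    generalize fderiv ℝ f (F z) (Pi.single j 1) = x
    generalize fderiv ℝ f (F z) (Pi.single j Complex.I) = y
  · conv_rhs => rw [← Complex.re_add_im (c j)]
    push_cast
    match_scalars <;> ring_nf <;> simp <;> ring
  · conv_rhs => rw [← Complex.re_add_im (c j)]
    simp only [map_add, map_mul, Complex.conj_ofReal, Complex.conj_I]
    push_cast
    match_scalars <;> ring_nf <;> simp <;> ring

/-- An entry of the Jacobian matrix of `F`. -/
lemma jac_entry (hF : ContDiffAt ℂ ω F z) (i j : Fin n) :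
    DifferentiableAt ℂ (fun w => fderiv ℂ F w (Pi.single i 1) j) z ∧
    ∀ k, fderiv ℂ (fun w => fderiv ℂ F w (Pi.single i 1) j) z (Pi.single k 1)
      = fderiv ℂ (fun w => fderiv ℂ F w (Pi.single k 1) j) z (Pi.single i 1) := by
  have hd : DifferentiableAt ℂ (fderiv ℂ F) z :=
    (hF.fderiv_right (m := 1) le_top).differentiableAt (by simp)
  have hs : IsSymmSndFDerivAt ℂ F z := hF.isSymmSndFDerivAt_of_omega
  have h1 : ∀ v, HasFDerivAt (fun w => fderiv ℂ F w v j)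
      ((ContinuousLinearMap.proj j) ∘L ((ContinuousLinearMap.apply ℂ (Fin n → ℂ) v) ∘L
        (fderiv ℂ (fderiv ℂ F) z))) z := fun v =>
    (ContinuousLinearMap.proj (R := ℂ) (φ := fun _ : Fin n => ℂ) j).hasFDerivAt.comp z
      ((ContinuousLinearMap.apply ℂ (Fin n → ℂ) v).hasFDerivAt.comp z hd.hasFDerivAt)
  refine ⟨(h1 _).differentiableAt, fun k => ?_⟩
  rw [(h1 _).fderiv, (h1 _).fderiv]
  simp only [ContinuousLinearMap.comp_apply, ContinuousLinearMap.apply_apply]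
  rw [hs.eq]

lemma sum_symm_cov (e : Fin n → Lam n) (he : ∀ i j, e i * e j = -(e j * e i))
    (H : Fin n → Fin n → ℂ) (hH : ∀ i j, H i j = H j i) : ∑ i, e i * ∑ j, H i j • e j = 0 := by
  have h : ∑ i, e i * ∑ j, H i j • e j = -∑ i, e i * ∑ j, H i j • e j := by
    simp only [Finset.mul_sum, mul_smul_comm]
    conv_lhs => rw [Finset.sum_comm]
    simp only [← Finset.sum_neg_distrib]
    refine Finset.sum_congr rfl fun i _ => Finset.sum_congr rfl fun j _ => ?_
    rw [he j i, hH, smul_neg]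
  generalize ∑ i, e i * ∑ j, H i j • e j = x at h
  have h2 : (2 : ℂ) • x = 0 := by
    rw [two_smul]
    nth_rewrite 1 [h]
    exact neg_add_cancel x
  exact (smul_eq_zero.1 h2).resolve_left two_ne_zero

lemma pull_cov_diff (hF : ContDiffAt ℂ ω F z) (a : Ix n) :
    DifferentiableAt ℝ (fun w => pull (fderiv ℂ F w) (cov a)) z ∧
    dAlong Sum.inl (fun w => pull (fderiv ℂ F w) (cov a)) z = 0 ∧
    dAlong Sum.inr (fun w => pull (fderiv ℂ F w) (cov a)) z = 0 := by
  have hu := jac_entry hF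
  have hur := fun i j => (hu i j).1.restrictScalars ℝ
  rcases a with j | j
  · have hd : ∀ i ∈ Finset.univ, DifferentiableAt ℝ
        (fun w => fderiv ℂ F w (Pi.single i 1) j • cov (Sum.inl i)) z :=
      fun i _ => (hur i j).smul_const _
    simp only [pull_cov_inl]
    refine ⟨DifferentiableAt.fun_sum hd, ?_, ?_⟩
    · simp only [dAlong, wirt_sum _ _ hd]
      simp_rw [wirt_smul_fun _ (hur _ j) (differentiableAt_const _), wirt_const, smul_zero,
        add_zero, wirt_inl_holo (hu _ j).1]
      exact sum_symm_cov _ (fun _ _ => cov_mul_cov _ _) _ fun i k => (hu k j).2 i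
    · simp only [dAlong, wirt_sum _ _ hd]
      simp_rw [wirt_smul_fun _ (hur _ j) (differentiableAt_const _), wirt_const, smul_zero,
        add_zero, wirt_inr_holo (hu _ j).1]
      simp
  · have hd : ∀ i ∈ Finset.univ, DifferentiableAt ℝ
        (fun w => (starRingEnd ℂ) (fderiv ℂ F w (Pi.single i 1) j) • cov (Sum.inr i)) z :=
      fun i _ => ((wirt_conj (hur i j) (Sum.inl i)).1).smul_const _
    simp only [pull_cov_inr]
    refine ⟨DifferentiableAt.fun_sum hd, ?_, ?_⟩
    · simp only [dAlong, wirt_sum _ _ hd]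
      simp_rw [wirt_smul_fun _ (wirt_conj (hur _ j) (Sum.inl j)).1 (differentiableAt_const _),
        wirt_const, smul_zero, add_zero, (wirt_conj (hur _ j) _).2, Sum.swap_inl,
        wirt_inr_holo (hu _ j).1]
      simp
    · simp only [dAlong, wirt_sum _ _ hd]
      simp_rw [wirt_smul_fun _ (wirt_conj (hur _ j) (Sum.inl j)).1 (differentiableAt_const _),
        wirt_const, smul_zero, add_zero, (wirt_conj (hur _ j) _).2, Sum.swap_inr,
        wirt_inl_holo (hu _ j).1]
      exact sum_symm_cov _ (fun _ _ => cov_mul_cov _ _) _ fun i k => by rw [(hu k j).2 i]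

lemma dAlong_mul {κ : Type*} [Fintype κ] (g : κ → Ix n) {A B : (Fin n → ℂ) → Lam n}
    (hA : DifferentiableAt ℝ A z) (hB : DifferentiableAt ℝ B z)
    (h : ∀ a, cov a * A z = -(A z * cov a)) :
    dAlong g (fun w => A w * B w) z = dAlong g A z * B z - A z * dAlong g B z := by
  simp only [dAlong, (wirt_mul _ hA hB).2, mul_add, Finset.sum_add_distrib, Finset.sum_mul,
    Finset.mul_sum, ← mul_assoc, h, neg_mul, Finset.sum_neg_distrib, sub_eq_add_neg]

lemma cov_mul_pull_cov (L : (Fin n → ℂ) →L[ℂ] (Fin n → ℂ)) (a b : Ix n) :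
    cov a * pull L (cov b) = -(pull L (cov b) * cov a) := by
  rw [cov, cov, pull_ι]
  exact eq_neg_of_add_eq_zero_left (ExteriorAlgebra.ι_add_mul_swap _ _)

lemma pull_const_diff (hF : ContDiffAt ℂ ω F z) (l : Lam n) :
    DifferentiableAt ℝ (fun w => pull (fderiv ℂ F w) l) z ∧
    dAlong Sum.inl (fun w => pull (fderiv ℂ F w) l) z = 0 ∧
    dAlong Sum.inr (fun w => pull (fderiv ℂ F w) l) z = 0 := by
  induction l using lam_induction with
  | one => simp [dAlong, wirt_const]
  | smul c x hx =>
    have hs : ∀ a, wirt a (fun w => c • pull (fderiv ℂ F w) x) z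
        = c • wirt a (fun w => pull (fderiv ℂ F w) x) z := fun a =>
      wirt_clm a (LinearMap.lsmul ℂ (Lam n) c) hx.1
    simp only [map_smul]
    refine ⟨hx.1.const_smul c, ?_, ?_⟩
    · simp only [dAlong, hs, mul_smul_comm, ← Finset.smul_sum]
      exact (congrArg (c • ·) hx.2.1).trans (smul_zero c)
    · simp only [dAlong, hs, mul_smul_comm, ← Finset.smul_sum]
      exact (congrArg (c • ·) hx.2.2).trans (smul_zero c)
  | add x y hx hy =>
    simp only [map_add]
    refine ⟨hx.1.add hy.1, ?_, ?_⟩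
    · simp only [dAlong, wirt_add _ hx.1 hy.1, mul_add, Finset.sum_add_distrib]
      exact (congrArg₂ (· + ·) hx.2.1 hy.2.1).trans (add_zero 0)
    · simp only [dAlong, wirt_add _ hx.1 hy.1, mul_add, Finset.sum_add_distrib]
      exact (congrArg₂ (· + ·) hx.2.2 hy.2.2).trans (add_zero 0)
  | mul a x hx =>
    have ha := pull_cov_diff hF a
    simp only [map_mul]
    refine ⟨(wirt_mul a ha.1 hx.1).1, ?_, ?_⟩
    · rw [dAlong_mul _ ha.1 hx.1 fun b => cov_mul_pull_cov _ _ _, ha.2.1, hx.2.1]; simp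
    · rw [dAlong_mul _ ha.1 hx.1 fun b => cov_mul_pull_cov _ _ _, ha.2.2, hx.2.2]; simp

lemma wirt_pull (hF : ContDiffAt ℂ ω F z) {f : (Fin n → ℂ) → Lam n}
    (hf : DifferentiableAt ℝ f z) (a : Ix n) :
    wirt a (fun w => pull (fderiv ℂ F w) (f w)) z
      = wirt a (fun w => pull (fderiv ℂ F w) (f z)) z + pull (fderiv ℂ F z) (wirt a f z) := by
  let b := Module.finBasis ℂ (Lam n)
  have hb : ∀ (L : (Fin n → ℂ) →L[ℂ] (Fin n → ℂ)) l,
      pull L l = ∑ k, b.coord k l • pull L (b k) := by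
    intro L l
    conv_lhs => rw [← b.sum_repr l]
    rw [map_sum]
    simp only [map_smul, Module.Basis.coord_apply]
  have hc : ∀ k, DifferentiableAt ℝ (fun w => b.coord k (f w)) z := fun k =>
    differentiableAt_clm _ hf
  have hp := fun k => (pull_const_diff hF (b k)).1
  have h1 : ∀ k ∈ Finset.univ, DifferentiableAt ℝ
      (fun w => b.coord k (f w) • pull (fderiv ℂ F w) (b k)) z := fun k _ => (hc k).smul (hp k)
  have h2 : ∀ k ∈ Finset.univ, DifferentiableAt ℝ
      (fun w => b.coord k (f z) • pull (fderiv ℂ F w) (b k)) z := fun k _ =>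
    (hp k).fun_const_smul (b.coord k (f z))
  rw [funext fun w => hb (fderiv ℂ F w) (f w), funext fun w => hb (fderiv ℂ F w) (f z),
    hb _ (wirt a f z), wirt_sum _ _ h1, wirt_sum _ _ h2, ← Finset.sum_add_distrib]
  refine Finset.sum_congr rfl fun k _ => ?_
  rw [wirt_smul_fun _ (hc k) (hp k), wirt_smul_fun _ (differentiableAt_const _) (hp k),
    wirt_const, zero_smul, zero_add, wirt_clm _ _ hf, add_comm]

/-- The operators `∂` and `∂̄` do not depend on the coordinates. -/
lemma dAlong_pull (hF : ContDiffAt ℂ ω F z) {f : (Fin n → ℂ) → Lam n}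
    (hf : DifferentiableAt ℝ f (F z)) :
    dAlong Sum.inl (fun w => pull (fderiv ℂ F w) (f (F w))) z
      = pull (fderiv ℂ F z) (dAlong Sum.inl f (F z)) ∧
    dAlong Sum.inr (fun w => pull (fderiv ℂ F w) (f (F w))) z
      = pull (fderiv ℂ F z) (dAlong Sum.inr f (F z)) := by
  have hFd : DifferentiableAt ℂ F z := hF.differentiableAt (by simp)
  have hfF : DifferentiableAt ℝ (fun w => f (F w)) z := hf.comp z (hFd.restrictScalars ℝ)
  obtain ⟨-, h1, h2⟩ := pull_const_diff hF (f (F z))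
  simp only [dAlong] at h1 h2 ⊢
  simp only [wirt_pull hF hfF, mul_add, Finset.sum_add_distrib, h1, h2, zero_add, map_sum, map_mul,
    (wirt_comp hFd hf _).1, (wirt_comp hFd hf _).2, map_smul, pull_cov_inl, pull_cov_inr,
    Finset.mul_sum, Finset.sum_mul, mul_smul_comm, smul_mul_assoc]
  exact ⟨Finset.sum_comm, Finset.sum_comm⟩

lemma wirt_pull_V01 (hF : ContDiffAt ℂ ω F z) {f : (Fin n → ℂ) → Lam n}
    (hf : DifferentiableAt ℝ f (F z)) (hv : f (F z) ∈ V01 n) (i : Fin n) :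
    wirt (Sum.inl i) (fun w => pull (fderiv ℂ F w) (f (F w))) z
      = ∑ j, fderiv ℂ F z (Pi.single i 1) j
        • pull (fderiv ℂ F z) (wirt (Sum.inl j) f (F z)) := by
  have hFd : DifferentiableAt ℂ F z := hF.differentiableAt (by simp)
  have hfF : DifferentiableAt ℝ (fun w => f (F w)) z := hf.comp z (hFd.restrictScalars ℝ)
  have h0 : ∀ l ∈ V01 n, wirt (Sum.inl i) (fun w => pull (fderiv ℂ F w) l) z = 0 := by
    intro l hl
    induction hl using Submodule.span_induction with
    | mem x hx =>
      obtain ⟨j, rfl⟩ := hx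
      have hur := fun k => (jac_entry hF k j).1.restrictScalars ℝ
      simp only [pull_cov_inr]
      rw [wirt_sum _ _ fun k _ => ((wirt_conj (hur k) (Sum.inl k)).1).smul_const _]
      refine Finset.sum_eq_zero fun k _ => ?_
      rw [wirt_smul_fun _ (wirt_conj (hur k) (Sum.inl k)).1 (differentiableAt_const _),
        wirt_const, (wirt_conj (hur k) _).2, Sum.swap_inl, wirt_inr_holo (jac_entry hF k j).1]
      simp
    | zero => simp [wirt_const]
    | add x y _ _ hx hy =>
      simp only [map_add]
      rw [wirt_add _ (pull_const_diff hF x).1 (pull_const_diff hF y).1, hx, hy, add_zero]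
    | smul c x _ hx =>
      simp only [map_smul]
      rw [wirt_smul_fun _ (differentiableAt_const c) (pull_const_diff hF x).1, hx, wirt_const]
      simp
  rw [wirt_pull hF hfF, h0 _ hv, zero_add, (wirt_comp hFd hf i).1, map_sum]
  simp only [map_smul]

/-- The operator `∂̄` on vector-valued forms does not depend on the coordinates. -/
lemma dbarVec_pull (hF : ContDiffAt ℂ ω F z) {φ φ' : (Fin n → ℂ) → Fin n → Lam n} {j : Fin n}
    (hφ : ∀ i, DifferentiableAt ℝ (fun w => φ w i) z)
    (hφ' : DifferentiableAt ℝ (fun w => φ' w j) (F z))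
    (h : ∀ᶠ w in 𝓝 z, pull (fderiv ℂ F w) (φ' (F w) j)
      = ∑ i, fderiv ℂ F w (Pi.single i 1) j • φ w i) :
    pull (fderiv ℂ F z) (dAlong Sum.inr (fun w => φ' w j) (F z))
      = ∑ i, fderiv ℂ F z (Pi.single i 1) j • dAlong Sum.inr (fun w => φ w i) z := by
  have hu := fun i => jac_entry hF i j
  have hur := fun i => (hu i).1.restrictScalars ℝ
  rw [← (dAlong_pull hF hφ').2]
  simp only [dAlong]
  have hs := fun i (_ : i ∈ Finset.univ) => (hur i).fun_smul (hφ i)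
  simp_rw [wirt_congr _ h, wirt_sum _ _ hs,
    wirt_smul_fun _ (hur _) (hφ _), wirt_inr_holo (hu _).1, zero_smul, zero_add, Finset.mul_sum,
    Finset.smul_sum, mul_smul_comm]
  exact Finset.sum_comm

/-- The bracket does not depend on the coordinates. -/
lemma bracketLoc_pull (hF : ContDiffAt ℂ ω F z) {φ φ' ψ ψ' : (Fin n → ℂ) → Fin n → Lam n}
    (j : Fin n)
    (hφ : ∀ i, DifferentiableAt ℝ (fun w => φ w i) z)
    (hψ : ∀ i, DifferentiableAt ℝ (fun w => ψ w i) z)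
    (hφ' : ∀ i, DifferentiableAt ℝ (fun w => φ' w i) (F z))
    (hψ' : ∀ i, DifferentiableAt ℝ (fun w => ψ' w i) (F z))
    (tφ : ∀ i, φ z i ∈ V01 n) (tψ : ∀ i, ψ z i ∈ V01 n)
    (tφ' : ∀ i, φ' (F z) i ∈ V01 n) (tψ' : ∀ i, ψ' (F z) i ∈ V01 n)
    (cφ : ∀ j, ∀ᶠ w in 𝓝 z, pull (fderiv ℂ F w) (φ' (F w) j)
      = ∑ i, fderiv ℂ F w (Pi.single i 1) j • φ w i)
    (cψ : ∀ j, ∀ᶠ w in 𝓝 z, pull (fderiv ℂ F w) (ψ' (F w) j)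
      = ∑ i, fderiv ℂ F w (Pi.single i 1) j • ψ w i) :
    pull (fderiv ℂ F z) (bracketLoc φ' ψ' (F z) j)
      = ∑ i, fderiv ℂ F z (Pi.single i 1) j • bracketLoc φ ψ z i := by
  have half : ∀ {α α' β β' : (Fin n → ℂ) → Fin n → Lam n},
      (∀ i, DifferentiableAt ℝ (fun w => β w i) z) →
      (∀ i, DifferentiableAt ℝ (fun w => β' w i) (F z)) →
      (∀ i, β' (F z) i ∈ V01 n) →
      (∀ j, pull (fderiv ℂ F z) (α' (F z) j) = ∑ i, fderiv ℂ F z (Pi.single i 1) j • α z i) →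
      (∀ᶠ w in 𝓝 z, pull (fderiv ℂ F w) (β' (F w) j)
        = ∑ i, fderiv ℂ F w (Pi.single i 1) j • β w i) →
      pull (fderiv ℂ F z) (∑ l, α' (F z) l * wirt (Sum.inl l) (fun w => β' w j) (F z))
        = (∑ i, fderiv ℂ F z (Pi.single i 1) j • ∑ k, α z k * wirt (Sum.inl k) (fun w => β w i) z)
          + ∑ k, ∑ i, fderiv ℂ (fun w => fderiv ℂ F w (Pi.single i 1) j) z (Pi.single k 1)
            • (α z k * β z i) := by
    intro α α' β β' hβ hβ' tβ' cα cβ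
    have hu := fun i => jac_entry hF i j
    have hur := fun i => (hu i).1.restrictScalars ℝ
    have e1 : pull (fderiv ℂ F z) (∑ l, α' (F z) l * wirt (Sum.inl l) (fun w => β' w j) (F z))
        = ∑ k, α z k * wirt (Sum.inl k) (fun w => pull (fderiv ℂ F w) (β' (F w) j)) z := by
      simp_rw [wirt_pull_V01 hF (hβ' j) (tβ' j), map_sum, map_mul, cα, Finset.mul_sum,
        Finset.sum_mul, smul_mul_assoc, mul_smul_comm]
      exact Finset.sum_comm
    rw [e1]
    have hs := fun i (_ : i ∈ Finset.univ) => (hur i).fun_smul (hβ i)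
    simp_rw [wirt_congr _ cβ, wirt_sum _ _ hs,
      wirt_smul_fun _ (hur _) (hβ _), wirt_inl_holo (hu _).1, Finset.mul_sum, mul_add,
      mul_smul_comm, Finset.sum_add_distrib, Finset.smul_sum]
    rw [add_comm]
    congr 1
    exact Finset.sum_comm
  have anti : ∀ x ∈ V01 n, ∀ y ∈ V01 n, x * y + y * x = 0 := by
    intro x hx y hy
    induction hx using Submodule.span_induction with
    | mem x hx =>
      obtain ⟨i, rfl⟩ := hx
      have := cov_mul_of_mem (Sum.inr i) 1 (by simpa using hy)
      simp [this]
    | zero => simp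
    | add a b _ _ ha hb =>
      rw [add_mul, mul_add, add_add_add_comm, ha, hb, add_zero]
    | smul c a _ ha => rw [smul_mul_assoc, mul_smul_comm, ← smul_add, ha, smul_zero]
  have h1 := half (α := φ) (α' := φ') hψ hψ' tψ' (fun j => (cφ j).self_of_nhds) (cψ j)
  have h2 := half (α := ψ) (α' := ψ') hφ hφ' tφ' (fun j => (cψ j).self_of_nhds) (cφ j)
  simp only [bracketLoc, Finset.sum_add_distrib, map_add, smul_add]
  rw [h1, h2, add_add_add_comm]
  refine add_eq_left.2 ?_
  conv_lhs => enter [2]; rw [Finset.sum_comm]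
  rw [← Finset.sum_add_distrib]
  refine Finset.sum_eq_zero fun k _ => ?_
  rw [← Finset.sum_add_distrib]
  refine Finset.sum_eq_zero fun i _ => ?_
  rw [(jac_entry hF i j).2 k, ← smul_add, anti _ (tφ k) _ (tψ i), smul_zero]

end Naturality

lemma wirt_dAlong {κ : Type*} [Fintype κ] (g : κ → Ix n) (a : Ix n)
    {f : (Fin n → ℂ) → Lam n} {z : Fin n → ℂ} {U : Set (Fin n → ℂ)} (hU : IsOpen U) (hz : z ∈ U)
    (hf : ContDiffOn ℝ ∞ f U) :
    wirt a (dAlong g f) z = ∑ k, cov (g k) * wirt a (wirt (g k) f) z := by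
  have hd : ∀ a, DifferentiableAt ℝ (wirt a f) z := fun a =>
    ((contDiffOn_wirt a hU hf).contDiffAt (hU.mem_nhds hz)).differentiableAt (by simp)
  have h1 : ∀ k ∈ Finset.univ, DifferentiableAt ℝ (fun w => cov (g k) * wirt (g k) f w) z :=
    fun k _ => (wirt_mul a (differentiableAt_const _) (hd (g k))).1
  rw [show dAlong g f = fun w => ∑ k, cov (g k) * wirt (g k) f w from rfl, wirt_sum _ _ h1]
  refine Finset.sum_congr rfl fun k _ => ?_
  rw [(wirt_mul a (differentiableAt_const _) (hd (g k))).2, wirt_const, zero_mul, zero_add]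

lemma dAlong_anticomm {κ κ' : Type*} [Fintype κ] [Fintype κ'] (g : κ → Ix n) (h : κ' → Ix n)
    {f : (Fin n → ℂ) → Lam n} {z : Fin n → ℂ} {U : Set (Fin n → ℂ)} (hU : IsOpen U) (hz : z ∈ U)
    (hf : ContDiffOn ℝ ∞ f U) : dAlong g (dAlong h f) z = -dAlong h (dAlong g f) z := by
  conv_lhs => rw [dAlong]
  conv_rhs => rw [dAlong]
  simp only [wirt_dAlong _ _ hU hz hf, Finset.mul_sum]
  rw [Finset.sum_comm, ← Finset.sum_neg_distrib]
  refine Finset.sum_congr rfl fun k _ => ?_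
  rw [← Finset.sum_neg_distrib]
  refine Finset.sum_congr rfl fun l _ => ?_
  rw [← mul_assoc, cov_mul_cov, wirt_comm _ _ (hf.contDiffAt (hU.mem_nhds hz)), neg_mul, mul_assoc]

lemma dAlong_congr {κ : Type*} [Fintype κ] (g : κ → Ix n) {f f' : (Fin n → ℂ) → Lam n}
    {z : Fin n → ℂ} (h : f =ᶠ[nhds z] f') : dAlong g f z = dAlong g f' z := by
  simp only [dAlong, wirt_congr _ h]

lemma contDiffOn_dAlong {κ : Type*} [Fintype κ] (g : κ → Ix n) {f : (Fin n → ℂ) → Lam n}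
    {U : Set (Fin n → ℂ)} (hU : IsOpen U) (hf : ContDiffOn ℝ ∞ f U) :
    ContDiffOn ℝ ∞ (dAlong g f) U :=
  ContDiffOn.sum fun k _ => contDiffOn_mul contDiffOn_const (contDiffOn_wirt (g k) hU hf)

/-! ### Forms on a complex manifold -/

section Manifold

variable {M : Type*} [TopologicalSpace M] [ChartedSpace (Fin n → ℂ) M]

/-- The points of the target of the chart `c` that correspond to points in the domain of `c'`. -/
def overlap (c c' : atlas (Fin n → ℂ) M) : Set (Fin n → ℂ) :=
  {z | z ∈ c.1.target ∧ c.1.symm z ∈ c'.1.source}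

/-- The change of coordinates from the chart `c` to the chart `c'`. -/
def trans (c c' : atlas (Fin n → ℂ) M) (z : Fin n → ℂ) : Fin n → ℂ := c'.1 (c.1.symm z)

/-- The Jacobian of the change of coordinates from `c` to `c'`. -/
def jac (c c' : atlas (Fin n → ℂ) M) (z : Fin n → ℂ) : (Fin n → ℂ) →L[ℂ] (Fin n → ℂ) :=
  fderiv ℂ (trans c c') z

lemma isOpen_overlap (c c' : atlas (Fin n → ℂ) M) : IsOpen (overlap c c') :=
  (c.1.symm.trans c'.1).open_source

lemma trans_mem {c c' : atlas (Fin n → ℂ) M} {z : Fin n → ℂ} (hz : z ∈ overlap c c') :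
    trans c c' z ∈ c'.1.target := c'.1.map_source hz.2

lemma contDiffAt_trans [IsManifold 𝓘(ℂ, Fin n → ℂ) ω M] {c c' : atlas (Fin n → ℂ) M}
    {z : Fin n → ℂ} (hz : z ∈ overlap c c') : ContDiffAt ℂ ω (trans c c') z := by
  have h := (contDiffGroupoid ω 𝓘(ℂ, Fin n → ℂ)).compatible c.2 c'.2
  have h' : ContDiffOn ℂ ω (trans c c') (overlap c c') := by
    have := contMDiffOn_of_mem_contDiffGroupoid h
    rw [contMDiffOn_iff_contDiffOn] at this
    exact this
  exact h'.contDiffAt ((isOpen_overlap c c').mem_nhds hz)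

variable (n M)

/-- Smooth complex differential forms (of mixed degree) on `M`: families of smooth forms on the
targets of the charts that are compatible under pull-back by the changes of coordinates. The value
outside the target of a chart is set to zero. -/
def formSubmodule : Submodule ℂ (atlas (Fin n → ℂ) M → (Fin n → ℂ) → Lam n) where
  carrier := {α | (∀ c, ContDiffOn ℝ ∞ (α c) c.1.target) ∧ (∀ c, ∀ z ∉ c.1.target, α c z = 0) ∧
    ∀ c c', ∀ z ∈ overlap c c', α c z = pull (jac c c' z) (α c' (trans c c' z))}
  zero_mem' := ⟨fun _ => contDiffOn_const, fun _ _ _ => rfl, fun _ _ _ _ => by simp⟩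
  add_mem' := fun {α β} hα hβ => ⟨fun c => (hα.1 c).add (hβ.1 c),
    fun c z hz => by simp [hα.2.1 c z hz, hβ.2.1 c z hz],
    fun c c' z hz => by simp [hα.2.2 c c' z hz, hβ.2.2 c c' z hz]⟩
  smul_mem' := fun r {α} hα => ⟨fun c => (hα.1 c).const_smul r,
    fun c z hz => by simp [hα.2.1 c z hz], fun c c' z hz => by simp [hα.2.2 c c' z hz]⟩

/-- Smooth forms of type `(0,q)` with values in the holomorphic tangent bundle `T^{1,0}`: in a
chart, such a form is `∑ⱼ φʲ ⊗ ∂/∂zʲ` with forms `φʲ` of type `(0,q)`. -/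
def vformSubmodule (q : ℕ) : Submodule ℂ (atlas (Fin n → ℂ) M → (Fin n → ℂ) → Fin n → Lam n) where
  carrier := {φ | (∀ c j, ContDiffOn ℝ ∞ (fun z => φ c z j) c.1.target) ∧
    (∀ c, ∀ z ∉ c.1.target, φ c z = 0) ∧ (∀ c z j, φ c z j ∈ bideg n 0 q) ∧
    ∀ c c', ∀ z ∈ overlap c c', ∀ j, pull (jac c c' z) (φ c' (trans c c' z) j)
      = ∑ i, jac c c' z (Pi.single i 1) j • φ c z i}
  zero_mem' := ⟨fun _ _ => contDiffOn_const, fun _ _ _ => rfl, fun _ _ _ => zero_mem _,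
    fun _ _ _ _ _ => by simp⟩
  add_mem' := fun {α β} hα hβ => ⟨fun c j => (hα.1 c j).add (hβ.1 c j),
    fun c z hz => by simp [hα.2.1 c z hz, hβ.2.1 c z hz],
    fun c z j => add_mem (hα.2.2.1 c z j) (hβ.2.2.1 c z j),
    fun c c' z hz j => by
      simp [hα.2.2.2 c c' z hz, hβ.2.2.2 c c' z hz, Finset.sum_add_distrib]⟩
  smul_mem' := fun r {α} hα => ⟨fun c j => (hα.1 c j).const_smul r,
    fun c z hz => by simp [hα.2.1 c z hz],
    fun c z j => Submodule.smul_mem _ _ (hα.2.2.1 c z j),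
    fun c c' z hz j => by simp [hα.2.2.2 c c' z hz, Finset.smul_sum, smul_comm r]⟩

/-- The space of smooth complex differential forms (of mixed degree) on `M`. -/
def Form : Type _ := ↥(formSubmodule n M)

/-- The space `A^{0,q}(M, T^{1,0})`. -/
def VForm (q : ℕ) : Type _ := ↥(vformSubmodule n M q)

instance : AddCommGroup (Form n M) := inferInstanceAs (AddCommGroup ↥(formSubmodule n M))

instance : Module ℂ (Form n M) := inferInstanceAs (Module ℂ ↥(formSubmodule n M))

instance (q : ℕ) : AddCommGroup (VForm n M q) :=
  inferInstanceAs (AddCommGroup ↥(vformSubmodule n M q))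

instance (q : ℕ) : Module ℂ (VForm n M q) := inferInstanceAs (Module ℂ ↥(vformSubmodule n M q))

variable {n M}

/-- The expression of a form in each chart. -/
def Form.val (α : Form n M) : atlas (Fin n → ℂ) M → (Fin n → ℂ) → Lam n := Subtype.val α

/-- The form with given expressions in the charts. -/
def Form.mk (f : atlas (Fin n → ℂ) M → (Fin n → ℂ) → Lam n) (h : f ∈ formSubmodule n M) :
    Form n M := ⟨f, h⟩

/-- The coefficients of `∂/∂zʲ` in each chart. -/
def VForm.val {q : ℕ} (φ : VForm n M q) : atlas (Fin n → ℂ) M → (Fin n → ℂ) → Fin n → Lam n :=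
  Subtype.val φ

/-- The vector-valued form with given coefficients in the charts. -/
def VForm.mk {q : ℕ} (f : atlas (Fin n → ℂ) M → (Fin n → ℂ) → Fin n → Lam n)
    (h : f ∈ vformSubmodule n M q) : VForm n M q := ⟨f, h⟩

namespace Form

variable (α β : Form n M) (c c' : atlas (Fin n → ℂ) M) {z : Fin n → ℂ}

@[simp] lemma mk_val (f : atlas (Fin n → ℂ) M → (Fin n → ℂ) → Lam n)
    (h : f ∈ formSubmodule n M) : (mk f h).val = f := rfl

@[simp] lemma add_val : (α + β).val = α.val + β.val := rfl

@[simp] lemma neg_val : (-α).val = -α.val := rfl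

@[simp] lemma sub_val : (α - β).val = α.val - β.val := rfl

@[simp] lemma zero_val : (0 : Form n M).val = 0 := rfl

@[simp] lemma smul_val (r : ℂ) : (r • α).val = r • α.val := rfl

lemma smooth : ContDiffOn ℝ ∞ (α.val c) c.1.target := α.2.1 c

lemma zero_off (hz : z ∉ c.1.target) : α.val c z = 0 := α.2.2.1 c z hz

lemma compat (hz : z ∈ overlap c c') :
    α.val c z = pull (jac c c' z) (α.val c' (trans c c' z)) := α.2.2.2 c c' z hz

lemma diff (hz : z ∈ c.1.target) : DifferentiableAt ℝ (α.val c) z :=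
  ((α.smooth c).contDiffAt (c.1.open_target.mem_nhds hz)).differentiableAt (by simp)

variable {α β} in
lemma ext_target (h : ∀ c, ∀ z ∈ c.1.target, α.val c z = β.val c z) : α = β := by
  apply Subtype.ext
  funext c z
  by_cases hz : z ∈ c.1.target
  · exact h c z hz
  · exact (α.zero_off c hz).trans (β.zero_off c hz).symm

end Form

namespace VForm

variable {q : ℕ} (φ ψ : VForm n M q) (c c' : atlas (Fin n → ℂ) M) {z : Fin n → ℂ} (j : Fin n)

@[simp] lemma mk_val (f : atlas (Fin n → ℂ) M → (Fin n → ℂ) → Fin n → Lam n)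
    (h : f ∈ vformSubmodule n M q) : (mk f h).val = f := rfl

@[simp] lemma add_val : (φ + ψ).val = φ.val + ψ.val := rfl

@[simp] lemma neg_val : (-φ).val = -φ.val := rfl

@[simp] lemma sub_val : (φ - ψ).val = φ.val - ψ.val := rfl

@[simp] lemma zero_val : (0 : VForm n M q).val = 0 := rfl

@[simp] lemma smul_val (r : ℂ) : (r • φ).val = r • φ.val := rfl

lemma smooth : ContDiffOn ℝ ∞ (fun z => φ.val c z j) c.1.target := φ.2.1 c j

lemma zero_off (hz : z ∉ c.1.target) : φ.val c z = 0 := φ.2.2.1 c z hz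

lemma type (z : Fin n → ℂ) : φ.val c z j ∈ bideg n 0 q := φ.2.2.2.1 c z j

lemma compat (hz : z ∈ overlap c c') : pull (jac c c' z) (φ.val c' (trans c c' z) j)
    = ∑ i, jac c c' z (Pi.single i 1) j • φ.val c z i := φ.2.2.2.2 c c' z hz j

lemma diff (hz : z ∈ c.1.target) : DifferentiableAt ℝ (fun w => φ.val c w j) z :=
  ((φ.smooth c j).contDiffAt (c.1.open_target.mem_nhds hz)).differentiableAt (by simp)

variable {φ ψ} in
lemma ext_target (h : ∀ c, ∀ z ∈ c.1.target, φ.val c z = ψ.val c z) : φ = ψ := by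
  apply Subtype.ext
  funext c z
  by_cases hz : z ∈ c.1.target
  · exact h c z hz
  · exact (φ.zero_off c hz).trans (ψ.zero_off c hz).symm

end VForm

variable [IsManifold 𝓘(ℂ, Fin n → ℂ) ω M]

lemma dForm_mem {g : Fin n → Ix n} (hg : g = Sum.inl ∨ g = Sum.inr) (α : Form n M) :
    (fun c => c.1.target.indicator (dAlong g (α.val c))) ∈ formSubmodule n M := by
  refine ⟨fun c => ?_, fun c z hz => Set.indicator_of_notMem hz _, fun c c' z hz => ?_⟩
  · exact (contDiffOn_dAlong g c.1.open_target (α.smooth c)).congr fun z hz =>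
      Set.indicator_of_mem hz _
  · beta_reduce
    rw [Set.indicator_of_mem hz.1, Set.indicator_of_mem (trans_mem hz)]
    have h : α.val c =ᶠ[nhds z] fun w => pull (jac c c' w) (α.val c' (trans c c' w)) := by
      filter_upwards [(isOpen_overlap c c').mem_nhds hz] with w hw using α.compat c c' hw
    rw [dAlong_congr g h]
    have := dAlong_pull (contDiffAt_trans hz) (α.diff c' (trans_mem hz))
    rcases hg with rfl | rfl
    exacts [this.1, this.2]

/-- The operator that is `∂` (for `g = Sum.inl`) or `∂̄` (for `g = Sum.inr`) in every chart. -/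
def dForm (g : Fin n → Ix n) (hg : g = Sum.inl ∨ g = Sum.inr) : Form n M →ₗ[ℂ] Form n M where
  toFun α := .mk (fun c => c.1.target.indicator (dAlong g (α.val c))) (dForm_mem hg α)
  map_add' α β := by
    refine Form.ext_target fun c z hz => ?_
    simp only [Form.mk_val, Form.add_val, Pi.add_apply, Set.indicator_of_mem hz, dAlong]
    rw [← Finset.sum_add_distrib]
    refine Finset.sum_congr rfl fun k _ => ?_
    rw [← mul_add, ← wirt_add _ (α.diff c hz) (β.diff c hz)]
    rfl
  map_smul' r α := by
    refine Form.ext_target fun c z hz => ?_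
    simp only [Form.mk_val, Form.smul_val, Pi.smul_apply, Set.indicator_of_mem hz, dAlong,
      RingHom.id_apply, Finset.smul_sum]
    refine Finset.sum_congr rfl fun k _ => ?_
    rw [← mul_smul_comm]
    congr 1
    exact wirt_clm _ (LinearMap.lsmul ℂ (Lam n) r) (α.diff c hz)

/-- The operator `∂`. -/
def del : Form n M →ₗ[ℂ] Form n M := dForm Sum.inl (Or.inl rfl)

/-- The operator `∂̄`. -/
def dbar : Form n M →ₗ[ℂ] Form n M := dForm Sum.inr (Or.inr rfl)

/-- The exterior derivative. -/
def dExt : Form n M →ₗ[ℂ] Form n M := del + dbar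

lemma dForm_anticomm (g h : Fin n → Ix n) (hg : g = Sum.inl ∨ g = Sum.inr)
    (hh : h = Sum.inl ∨ h = Sum.inr) (α : Form n M) :
    dForm g hg (dForm h hh α) = -dForm h hh (dForm g hg α) := by
  refine Form.ext_target fun c z hz => ?_
  have e : ∀ (g h : Fin n → Ix n) (hg : g = Sum.inl ∨ g = Sum.inr)
      (hh : h = Sum.inl ∨ h = Sum.inr),
      (dForm g hg (dForm h hh α)).val c z = dAlong g (dAlong h (α.val c)) z := by
    intro g h hg hh
    refine (Set.indicator_of_mem hz _).trans (dAlong_congr g ?_)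
    filter_upwards [c.1.open_target.mem_nhds hz] with w hw using Set.indicator_of_mem hw _
  rw [e, Form.neg_val, Pi.neg_apply, Pi.neg_apply, e]
  exact dAlong_anticomm g h c.1.open_target hz (α.smooth c)

lemma eq_zero_of_eq_neg {x : Form n M} (h : x = -x) : x = 0 := by
  have h2 : (2 : ℂ) • x = 0 := by
    rw [two_smul]
    nth_rewrite 1 [h]
    exact neg_add_cancel x
  exact (smul_eq_zero.1 h2).resolve_left two_ne_zero

lemma del_del (α : Form n M) : del (del α) = 0 := eq_zero_of_eq_neg (dForm_anticomm _ _ _ _ α)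

lemma dbar_dbar (α : Form n M) : dbar (dbar α) = 0 := eq_zero_of_eq_neg (dForm_anticomm _ _ _ _ α)

lemma del_dbar (α : Form n M) : del (dbar α) = -dbar (del α) := dForm_anticomm _ _ _ _ α

lemma dExt_dExt (α : Form n M) : dExt (dExt α) = 0 := by
  simp only [dExt, LinearMap.add_apply, map_add, del_del, dbar_dbar, del_dbar]
  abel

lemma dAlong_inr_mem {q : ℕ} {f : (Fin n → ℂ) → Lam n} {z : Fin n → ℂ}
    (hf : DifferentiableAt ℝ f z) (h : ∀ w, f w ∈ bideg n 0 q) :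
    dAlong Sum.inr f z ∈ bideg n 0 ((q + 1 : ℕ) : ℤ) := by
  rw [bideg_zero_natCast, pow_succ']
  refine Submodule.sum_mem _ fun k _ => Submodule.mul_mem_mul (Submodule.subset_span ⟨k, rfl⟩) ?_
  rw [← bideg_zero_natCast]
  exact wirt_mem _ _ hf (Filter.Eventually.of_forall h)

/-- The operator `∂̄` on forms with values in `T^{1,0}`: `∂̄(∑ⱼ φʲ ⊗ ∂/∂zʲ) = ∑ⱼ ∂̄φʲ ⊗ ∂/∂zʲ`. -/
def dbarV (q : ℕ) : VForm n M q →ₗ[ℂ] VForm n M (q + 1) where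
  toFun φ := .mk (fun c => c.1.target.indicator fun z j => dAlong Sum.inr (fun w => φ.val c w j) z) (by
    refine ⟨fun c j => ?_, fun c z hz => Set.indicator_of_notMem hz _, fun c z j => ?_,
      fun c c' z hz j => ?_⟩
    · refine (contDiffOn_dAlong Sum.inr c.1.open_target (φ.smooth c j)).congr fun z hz => ?_
      beta_reduce; rw [Set.indicator_of_mem hz]
    · by_cases hz : z ∈ c.1.target
      · beta_reduce; rw [Set.indicator_of_mem hz]
        exact dAlong_inr_mem (φ.diff c j hz) fun w => φ.type c j w
      · beta_reduce; rw [Set.indicator_of_notMem hz]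
        exact zero_mem _
    · simp only [Set.indicator_of_mem hz.1, Set.indicator_of_mem (trans_mem hz)]
      refine dbarVec_pull (contDiffAt_trans hz) (fun i => φ.diff c i hz.1) (φ.diff c' j (trans_mem hz)) ?_
      filter_upwards [(isOpen_overlap c c').mem_nhds hz] with w hw using φ.compat c c' j hw)
  map_add' α β := by
    refine VForm.ext_target fun c z hz => ?_
    funext j
    simp only [VForm.mk_val, VForm.add_val, Pi.add_apply, Set.indicator_of_mem hz, dAlong]
    rw [← Finset.sum_add_distrib]
    refine Finset.sum_congr rfl fun k _ => ?_
    rw [← mul_add, ← wirt_add _ (α.diff c j hz) (β.diff c j hz)]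
  map_smul' r α := by
    refine VForm.ext_target fun c z hz => ?_
    funext j
    simp only [VForm.mk_val, VForm.smul_val, Pi.smul_apply, Set.indicator_of_mem hz, dAlong,
      RingHom.id_apply, Finset.smul_sum]
    refine Finset.sum_congr rfl fun k _ => ?_
    rw [← mul_smul_comm]
    congr 1
    exact wirt_clm _ (LinearMap.lsmul ℂ (Lam n) r) (α.diff c j hz)

lemma contrLoc_smooth {φ : (Fin n → ℂ) → Fin n → Lam n} {f : (Fin n → ℂ) → Lam n}
    {U : Set (Fin n → ℂ)} (hφ : ∀ j, ContDiffOn ℝ ∞ (fun z => φ z j) U)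
    (hf : ContDiffOn ℝ ∞ f U) : ContDiffOn ℝ ∞ (fun z => contrLoc (φ z) (f z)) U :=
  ContDiffOn.sum fun i _ => contDiffOn_mul (hφ i) (contDiffOn_clm (contr i) hf)

/-- The contraction `i_φ α` of a form `α` with a form `φ` with values in `T^{1,0}`. -/
def contrForm (q : ℕ) : VForm n M q →ₗ[ℂ] Form n M →ₗ[ℂ] Form n M :=
  LinearMap.mk₂ ℂ
    (fun φ α => .mk (fun c z => contrLoc (φ.val c z) (α.val c z))
      ⟨fun c => contrLoc_smooth (φ.smooth c) (α.smooth c),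
      fun c z hz => by simp [contrLoc, α.zero_off c hz],
      fun c c' z hz => by
        simp only [α.compat c c' hz]
        exact (contrLoc_pull _ _ _ _ fun j => φ.compat c c' j hz).symm⟩)
    (fun φ ψ α => Form.ext_target fun c z _ => by
      simp [contrLoc, add_mul, Finset.sum_add_distrib])
    (fun r φ α => Form.ext_target fun c z _ => by
      simp [contrLoc, Finset.smul_sum])
    (fun φ α β => Form.ext_target fun c z _ => by
      simp [contrLoc, mul_add, Finset.sum_add_distrib])
    (fun r φ α => Form.ext_target fun c z _ => by
      simp [contrLoc, Finset.smul_sum])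

/-- The bracket `[φ,ψ]` of two forms of type `(0,1)` with values in `T^{1,0}`. -/
def bracket (φ ψ : VForm n M 1) : VForm n M 2 :=
  .mk (fun c => c.1.target.indicator (bracketLoc (φ.val c) (ψ.val c))) (by
    have t : ∀ (φ : VForm n M 1) c z j, φ.val c z j ∈ V01 n := fun φ c z j => by
      have := φ.type c j z
      rwa [bideg_zero_natCast, pow_one] at this
    refine ⟨fun c j => ?_, fun c z hz => Set.indicator_of_notMem hz _, fun c z j => ?_,
      fun c c' z hz j => ?_⟩
    · have h : ContDiffOn ℝ ∞ (fun z => bracketLoc (φ.val c) (ψ.val c) z j) c.1.target :=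
        ContDiffOn.sum fun i _ =>
          (contDiffOn_mul (φ.smooth c i) (contDiffOn_wirt _ c.1.open_target (ψ.smooth c j))).add
            (contDiffOn_mul (ψ.smooth c i) (contDiffOn_wirt _ c.1.open_target (φ.smooth c j)))
      refine h.congr fun z hz => ?_
      beta_reduce; rw [Set.indicator_of_mem hz]
    · by_cases hz : z ∈ c.1.target
      · beta_reduce; rw [Set.indicator_of_mem hz, bideg_zero_natCast, pow_two]
        have m : ∀ (φ : VForm n M 1) i, wirt (Sum.inl i) (fun w => φ.val c w j) z ∈ V01 n :=
          fun φ i => wirt_mem _ _ (φ.diff c j hz) (Filter.Eventually.of_forall fun w => t φ c w j)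
        exact Submodule.sum_mem _ fun i _ => add_mem
          (Submodule.mul_mem_mul (t φ c z i) (m ψ i)) (Submodule.mul_mem_mul (t ψ c z i) (m φ i))
      · beta_reduce; rw [Set.indicator_of_notMem hz]
        exact zero_mem _
    · simp only [Set.indicator_of_mem hz.1, Set.indicator_of_mem (trans_mem hz)]
      refine bracketLoc_pull (contDiffAt_trans hz) j (fun i => φ.diff c i hz.1) (fun i => ψ.diff c i hz.1)
        (fun i => φ.diff c' i (trans_mem hz)) (fun i => ψ.diff c' i (trans_mem hz)) (t φ c z) (t ψ c z)
        (t φ c' _) (t ψ c' _) (fun j => ?_) (fun j => ?_)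
      · filter_upwards [(isOpen_overlap c c').mem_nhds hz] with w hw using φ.compat c c' j hw
      · filter_upwards [(isOpen_overlap c c').mem_nhds hz] with w hw using ψ.compat c c' j hw)

/-- `∂̄(i_φ α) = i_{∂̄φ} α - (-1)^q i_φ ∂̄α` for `φ` of type `(0,q)`. -/
lemma dbar_contrForm {q : ℕ} (φ : VForm n M q) (α : Form n M) :
    dbar (contrForm q φ α)
      = contrForm (q + 1) (dbarV q φ) α - (-1 : ℂ) ^ q • contrForm q φ (dbar α) := by
  refine Form.ext_target fun c z hz => ?_
  have e1 : (dbar (contrForm q φ α)).val c z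
      = dAlong Sum.inr (fun w => contrLoc (φ.val c w) (α.val c w)) z := Set.indicator_of_mem hz _
  have e2 : (contrForm (q + 1) (dbarV q φ) α).val c z
      = contrLoc (fun j => dAlong Sum.inr (fun w => φ.val c w j) z) (α.val c z) := by
    change contrLoc (c.1.target.indicator
      (fun z j => dAlong Sum.inr (fun w => φ.val c w j) z) z) _ = _
    rw [Set.indicator_of_mem hz]
  have e3 : (contrForm q φ (dbar α)).val c z
      = contrLoc (φ.val c z) (dAlong Sum.inr (α.val c) z) := by
    change contrLoc _ (c.1.target.indicator (dAlong Sum.inr (α.val c)) z) = _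
    rw [Set.indicator_of_mem hz]
  rw [Form.sub_val, Form.smul_val, Pi.sub_apply, Pi.sub_apply, Pi.smul_apply,
    Pi.smul_apply, e1, e2, e3]
  have hd : ∀ i, DifferentiableAt ℝ (fun w => contr i (α.val c w)) z := fun i =>
    differentiableAt_clm _ (α.diff c hz)
  have hs : ∀ i ∈ Finset.univ, DifferentiableAt ℝ (fun w => φ.val c w i * contr i (α.val c w)) z :=
    fun i _ => (wirt_mul (Sum.inl i) (φ.diff c i hz) (hd i)).1
  simp only [contrLoc, dAlong, wirt_sum _ _ hs, map_sum, contr_cov_mul, reduceCtorEq, if_false,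
    zero_sub, Finset.mul_sum, Finset.sum_mul, Finset.smul_sum]
  rw [Finset.sum_comm, ← Finset.sum_sub_distrib]
  refine Finset.sum_congr rfl fun i _ => ?_
  rw [← Finset.sum_sub_distrib]
  refine Finset.sum_congr rfl fun k _ => ?_
  rw [(wirt_mul _ (φ.diff c i hz) (hd i)).2, wirt_clm _ _ (α.diff c hz)]
  have h := φ.type c i z
  rw [bideg_zero_natCast] at h
  rw [mul_add, ← mul_assoc, ← mul_assoc, cov_mul_of_mem _ q h, smul_mul_assoc]
  simp only [mul_neg, smul_neg, sub_neg_eq_add, mul_assoc]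

/-! ### Dolbeault cohomology and the contraction map -/

/-- Forms of type `(p,q)`. -/
def Apq (p q : ℤ) : Submodule ℂ (Form n M) where
  carrier := {α | ∀ c z, α.val c z ∈ bideg n p q}
  zero_mem' := fun _ _ => zero_mem _
  add_mem' := fun hα hβ c z => add_mem (hα c z) (hβ c z)
  smul_mem' := fun r _ hα c z => Submodule.smul_mem _ r (hα c z)

lemma contrForm_mem {p q : ℤ} {r : ℕ} (φ : VForm n M r) {α : Form n M} (hα : α ∈ Apq p q) :
    contrForm r φ α ∈ Apq (p - 1) (q + r) :=
  fun c z => contrLoc_mem (fun i => φ.type c i z) (hα c z)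

/-- `∂̄`-closed forms of type `(p,q)`. -/
def Zdbar (p q : ℤ) : Submodule ℂ (Form n M) := Apq p q ⊓ LinearMap.ker dbar

/-- `∂̄`-exact forms of type `(p,q)`. -/
def Bdbar (p q : ℤ) : Submodule ℂ (Form n M) := (Apq p (q - 1)).map dbar

variable (n M)

/-- The Dolbeault cohomology `H^{p,q}_∂̄(M)`. -/
abbrev Hdbar (p q : ℤ) : Type _ :=
  ↥(Zdbar (n := n) (M := M) p q) ⧸ (Bdbar (n := n) (M := M) p q).comap (Zdbar p q).subtype

/-- The Dolbeault cohomology `H^{0,2}_∂̄(M, T^{1,0})`. -/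
abbrev H02T : Type _ :=
  ↥(LinearMap.ker (dbarV (n := n) (M := M) 2)) ⧸
    (LinearMap.range (dbarV (n := n) (M := M) 1)).comap (LinearMap.ker (dbarV 2)).subtype

variable {n M}

/-- Contraction with a `∂̄`-closed `σ` of type `(0,2)`, on `∂̄`-closed forms. -/
def contrZ (p q : ℤ) (σ : LinearMap.ker (dbarV (n := n) (M := M) 2)) :
    Zdbar (n := n) (M := M) p q →ₗ[ℂ] Zdbar (n := n) (M := M) (p - 1) (q + 2) :=
  (contrForm 2 σ.1).restrict fun α hα => ⟨contrForm_mem σ.1 hα.1, by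
    have h := dbar_contrForm σ.1 α
    rw [LinearMap.mem_ker.1 σ.2, LinearMap.mem_ker.1 hα.2] at h
    simpa using h⟩

lemma contrZ_val (p q : ℤ) (σ : LinearMap.ker (dbarV (n := n) (M := M) 2))
    (α : Zdbar (n := n) (M := M) p q) : (contrZ p q σ α).1 = contrForm 2 σ.1 α.1 := rfl

/-- The map `[α] ↦ [i_σ α]` from `H^{p,q}` to `H^{p-1,q+2}`, for a `∂̄`-closed `σ`. -/
def contrH (p q : ℤ) (σ : LinearMap.ker (dbarV (n := n) (M := M) 2)) :
    Hdbar n M p q →ₗ[ℂ] Hdbar n M (p - 1) (q + 2) :=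
  Submodule.mapQ _ _ (contrZ p q σ) (by
    rintro ⟨_, hz⟩ ⟨β, hβ, rfl⟩
    have h := dbar_contrForm σ.1 β
    rw [LinearMap.mem_ker.1 σ.2] at h
    refine ⟨-contrForm 2 σ.1 β, ?_, ?_⟩
    · have := contrForm_mem σ.1 hβ
      rw [show q + 2 - 1 = q - 1 + ((2 : ℕ) : ℤ) by push_cast; ring]
      exact Submodule.neg_mem _ this
    · rw [map_neg, h]
      simp [contrZ_val])

/-- The component `μ_{p,q} : H^{0,2}(M, T^{1,0}) → Hom(H^{p,q}(M), H^{p-1,q+2}(M))`,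
`[σ] ↦ ([α] ↦ [i_σ α])`, of the contraction map. -/
def mu (p q : ℤ) : H02T n M →ₗ[ℂ] (Hdbar n M p q →ₗ[ℂ] Hdbar n M (p - 1) (q + 2)) :=
  Submodule.liftQ _
    { toFun := contrH p q
      map_add' := fun σ τ => by
        refine Submodule.linearMap_qext _ (LinearMap.ext fun α => ?_)
        exact congrArg (Submodule.mkQ _) (Subtype.ext (by simp [contrZ_val]) :
          contrZ p q (σ + τ) α = contrZ p q σ α + contrZ p q τ α)
      map_smul' := fun r σ => by
        refine Submodule.linearMap_qext _ (LinearMap.ext fun α => ?_)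
        exact congrArg (Submodule.mkQ _) (Subtype.ext (by simp [contrZ_val]) :
          contrZ p q (r • σ) α = r • contrZ p q σ α) }
    (by
      rintro ⟨_, hσ⟩ ⟨τ, rfl⟩
      rw [LinearMap.mem_ker]
      refine Submodule.linearMap_qext _ (LinearMap.ext fun α => ?_)
      refine (Submodule.Quotient.mk_eq_zero _).2 ⟨contrForm 1 τ α.1, ?_, ?_⟩
      · rw [show q + 2 - 1 = q + ((1 : ℕ) : ℤ) by push_cast; ring]
        exact contrForm_mem τ α.2.1
      · have h := dbar_contrForm τ α.1
        rw [LinearMap.mem_ker.1 α.2.2] at h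
        simpa [contrZ_val] using h)

/-! ### The Frölicher spectral sequence -/

/-- `F^p A^k = ⨁_{l ≥ p} A^{l,k-l}`. -/
def Fil (p k : ℤ) : Submodule ℂ (Form n M) := ⨆ (l : ℤ) (_ : p ≤ l), Apq l (k - l)

/-- `Z_r^{p,q} = F^p A^{p+q} ∩ d⁻¹(F^{p+r} A^{p+q+1})`. -/
def Zr (r p q : ℤ) : Submodule ℂ (Form n M) :=
  Fil p (p + q) ⊓ (Fil (p + r) (p + q + 1)).comap dExt

/-- `B_r^{p,q} = F^p A^{p+q} ∩ d(F^{p-r} A^{p+q-1})`. -/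
def Br (r p q : ℤ) : Submodule ℂ (Form n M) :=
  Fil p (p + q) ⊓ (Fil (p - r) (p + q - 1)).map dExt

variable (n M)

/-- `E_r^{p,q} = Z_r^{p,q} / (Z_{r-1}^{p+1,q-1} + B_{r-1}^{p,q})`. -/
abbrev Er (r p q : ℤ) : Type _ :=
  ↥(Zr (n := n) (M := M) r p q) ⧸
    (Zr (n := n) (M := M) (r - 1) (p + 1) (q - 1) ⊔ Br (r - 1) p q).comap (Zr r p q).subtype

/-- The differential `d_r^{p,q} : E_r^{p,q} → E_r^{p+r,q-r+1}` induced by `d`. -/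
def dr (r p q : ℤ) : Er n M r p q →ₗ[ℂ] Er n M r (p + r) (q - r + 1) :=
  Submodule.mapQ _ _
    (dExt.restrict fun α hα => by
      refine ⟨?_, ?_⟩
      · rw [show p + r + (q - r + 1) = p + q + 1 by ring]
        exact hα.2
      · change dExt (dExt α) ∈ Fil (p + r + r) (p + r + (q - r + 1) + 1)
        rw [dExt_dExt]
        exact zero_mem _)
    (by
      rintro ⟨x, hx⟩ h
      obtain ⟨y, hy, w, hw, rfl⟩ := Submodule.mem_sup.1 h
      obtain ⟨-, v, -, rfl⟩ := hw
      refine Submodule.mem_sup_right ?_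
      have e : dExt (y + dExt v) = dExt y := by rw [map_add, dExt_dExt, add_zero]
      change dExt (y + dExt v) ∈ Br (r - 1) (p + r) (q - r + 1)
      rw [e]
      refine ⟨?_, y, ?_, rfl⟩
      · have : dExt y ∈ Fil _ _ := hy.2
        change dExt y ∈ Fil (p + r) (p + r + (q - r + 1))
        rwa [show p + r + (q - r + 1) = p + 1 + (q - 1) + 1 by ring,
          show p + r = p + 1 + (r - 1) by ring]
      · have : y ∈ Fil _ _ := hy.1
        change y ∈ Fil (p + r - (r - 1)) (p + r + (q - r + 1) - 1)
        rwa [show p + r - (r - 1) = p + 1 by ring,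
          show p + r + (q - r + 1) - 1 = p + 1 + (q - 1) by ring])

/-! ### Deformations -/

variable {n M}

/-- `φ₁,…,φ_N` is a deformation of order `N`: `∂̄φₖ = ½ ∑_{0<j<k} [φⱼ,φ_{k-j}]` for `k = 1,…,N`.
If the deformation depends on several parameters, then `φⱼ` is the value at any given parameter of
the homogeneous component of degree `j`. -/
def IsDeformation (N : ℕ) (φ : ℕ → VForm n M 1) : Prop :=
  ∀ k ∈ Finset.Icc 1 N, dbarV 1 (φ k) = (1 / 2 : ℂ) • ∑ j ∈ Finset.Ico 1 k, bracket (φ j) (φ (k - j))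

/-- The obstruction `∑_{j=1}^N [φⱼ,φ_{N+1-j}]` to extending a deformation of order `N`. -/
def obstruction (N : ℕ) (φ : ℕ → VForm n M 1) : VForm n M 2 :=
  ∑ j ∈ Finset.Icc 1 N, bracket (φ j) (φ (N + 1 - j))

end Manifold

end Frolicher

end

noncomputable section

set_option linter.unusedSectionVars false

namespace Frolicher

variable {n : ℕ}

/-! ### Commutation rules for contractions -/

/-! The argument has two ingredients: a three-term conjugation formula for `d`, and strictness of
`d` for the Hodge filtration in the relevant degree.

Conjugation. The commutator of `∂` with `i_φ` is a first-order operator `L_φ` of bidegree `(0,1)`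
(`del_contrLoc`, `lieForm_val`), and `[L_φ, i_ψ] = -i_{[φ,ψ]}` (`lieForm_mul_contrForm`), while
contractions with forms of type `(0,2)` commute with `i_φ` (`contrForm_comm`). Hence, for the series
`A = ∑ i_{φₖ} tᵏ`, conjugating `d` by `exp A` stops at the double commutator (`mul_divPow`,
`dExt_mul_expCoeff`): `exp(-A) d exp(A) = ∑ Dₖ tᵏ` with `D₀ = d` and, for `k ≥ 1`, `Dₖ = L_{φₖ} +
i_{∂̄φₖ - ½[φ,φ]ₖ}`. After truncating the family to `1,…,N`, the deformation equation leaves `Dₖ =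
L_{φₖ}` for `1 ≤ k ≤ N`, which preserves `F^p` although `i_{φₖ}` does not, and `D_{N+1} = -½ i_σ`
with `σ` the obstruction.

Strictness. The vanishing differentials imply that a `d`-exact form of degree `p+q+1` lying in
`F^m`, with `m` one of `p-1, p, p+1`, has a primitive in `F^m` (`exists_dExt_eq`).

Conclusion (`contrForm_obstruction_mem`). Let `α` be a `∂̄`-closed `(p,q)`-form. Since `dα = ∂α`
lies in `F^{p+1}`, strictness gives `β` in `F^{p+1}` with `dβ = dα`, so `a₀ = α - β` is `d`-closed.
It is extended to `a = ∑ aⱼ tʲ` with coefficients in `F^p` solving `Da = 0` up to order `N`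
(`exists_solution`): at each order the error lies in `F^p` and is exact because `d exp(A) a = exp(A)
D a`, so strictness allows a correction inside `F^p`. At order `N+1` the error `-½ i_σ α` plus a
term of `F^p` is again exact. A primitive in `F^{p-1}` has a `(p-1,q+1)`-component whose `∂̄` is `-½
i_σ α`.

That `σ` is `∂̄`-closed is the Leibniz rule for `∂̄[φ,φ]` combined with the Jacobi identity. -/

lemma contr_contr (i j : Fin n) (x : Lam n) : contr i (contr j x) = -contr j (contr i x) :=
  CliffordAlgebra.contractLeft_comm _ _ _

lemma V01_mul_comm {q : ℕ} {u x : Lam n} (hu : u ∈ V01 n) (hx : x ∈ V01 n ^ q) :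
    u * x = (-1 : ℂ) ^ q • (x * u) := by
  induction hu using Submodule.span_induction with
  | mem u hu => obtain ⟨i, rfl⟩ := hu; exact cov_mul_of_mem _ q hx
  | zero => simp
  | add u v _ _ hu hv => rw [add_mul, mul_add, hu, hv, smul_add]
  | smul c u _ hu => rw [smul_mul_assoc, mul_smul_comm, hu, smul_comm]

lemma V01_anticomm {u v : Lam n} (hu : u ∈ V01 n) (hv : v ∈ V01 n) : u * v = -(v * u) := by
  simpa using V01_mul_comm (q := 1) hu (by simpa using hv)

/-- Contraction is an antiderivation and kills every `dz̄ᵏ`, so only the sign from passing `q`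
covectors remains. -/
lemma contr_V01_pow_mul (i : Fin n) {q : ℕ} {u : Lam n} (hu : u ∈ V01 n ^ q) (x : Lam n) :
    contr i (u * x) = (-1 : ℂ) ^ q • (u * contr i x) := by
  induction q generalizing u x with
  | zero =>
    rw [pow_zero, Submodule.mem_one] at hu
    obtain ⟨c, rfl⟩ := hu
    simp [Algebra.algebraMap_eq_smul_one]
  | succ q ih =>
    rw [pow_succ'] at hu
    induction hu using Submodule.mul_induction_on' with
    | add u _ v _ hu hv => rw [add_mul, add_mul, map_add, hu, hv, smul_add]
    | mem_mul_mem u hu v hv =>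
      induction hu using Submodule.span_induction with
      | mem u hu =>
        obtain ⟨k, rfl⟩ := hu
        rw [mul_assoc, contr_cov_mul, if_neg (by simp), ih hv, pow_succ]
        simp [mul_assoc]
      | zero => simp
      | add u w _ _ hu hw => rw [add_mul, add_mul, map_add, hu, hw, add_mul, smul_add]
      | smul c u _ hu =>
        rw [smul_mul_assoc, smul_mul_assoc, map_smul, hu, smul_mul_assoc, smul_comm]

lemma contr_V01_mul (i : Fin n) {u : Lam n} (hu : u ∈ V01 n) (x : Lam n) :
    contr i (u * x) = -(u * contr i x) := by
  simpa using contr_V01_pow_mul (q := 1) i (by simpa using hu) x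

/-- Contraction with a vector-valued covector of type `(0,1)` commutes with contractions with
vector-valued covectors of type `(0,q)`. -/
lemma contrLoc_comm {q : ℕ} {φ σ : Fin n → Lam n} (hφ : ∀ i, φ i ∈ V01 n)
    (hσ : ∀ i, σ i ∈ V01 n ^ q) (x : Lam n) :
    contrLoc σ (contrLoc φ x) = contrLoc φ (contrLoc σ x) := by
  simp only [contrLoc, map_sum, Finset.mul_sum]
  rw [Finset.sum_comm]
  refine Finset.sum_congr rfl fun i _ => Finset.sum_congr rfl fun j _ => ?_
  -- Four signs cancel: `(-1)^q` from contracting past `σʲ` against `(-1)^q` from moving `φⁱ` past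
  -- `σʲ`, and the sign from contracting past `φⁱ` against the sign from exchanging the two
  -- contractions.
  rw [contr_V01_mul j (hφ i), contr_V01_pow_mul i (hσ j), mul_smul_comm, ← mul_assoc,
    V01_mul_comm (hφ i) (hσ j), contr_contr i j, smul_mul_assoc, smul_smul, ← mul_pow]
  simp [mul_assoc]

/-! ### The Lie derivative along a form of type `(0,1)` -/

/-- The commutator of `∂` and `i_φ` in a chart, for `φ` of type `(0,1)`. -/
def lieLoc (φ : (Fin n → ℂ) → Fin n → Lam n) (f : (Fin n → ℂ) → Lam n) (z : Fin n → ℂ) : Lam n :=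
  ∑ i, (dAlong Sum.inl (fun w => φ w i) z * contr i (f z) - φ z i * wirt (Sum.inl i) f z)

section

variable {φ ψ : (Fin n → ℂ) → Fin n → Lam n} {f : (Fin n → ℂ) → Lam n} {z : Fin n → ℂ}

lemma wirt_contrLoc (a : Ix n) (hφ : ∀ i, DifferentiableAt ℝ (fun w => φ w i) z)
    (hf : DifferentiableAt ℝ f z) :
    wirt a (fun w => contrLoc (φ w) (f w)) z
      = ∑ i, (wirt a (fun w => φ w i) z * contr i (f z) + φ z i * contr i (wirt a f z)) := by
  have hd : ∀ i, DifferentiableAt ℝ (fun w => contr i (f w)) z := fun i =>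
    differentiableAt_clm _ hf
  have hs : ∀ i ∈ Finset.univ, DifferentiableAt ℝ (fun w => φ w i * contr i (f w)) z :=
    fun i _ => (wirt_mul a (hφ i) (hd i)).1
  simp only [contrLoc, wirt_sum _ _ hs]
  refine Finset.sum_congr rfl fun i _ => ?_
  rw [(wirt_mul a (hφ i) (hd i)).2, wirt_clm _ _ hf]

/-- In `i_φ(dzᵏ ∧ ∂ₖf)` the contraction either hits `dzᵏ`, which produces the term `φᵏ ∧ ∂ₖf`, or
passes it, and the second kind cancels against the terms of `∂(i_φ f)` in which `f` is
differentiated. -/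
lemma del_contrLoc (hφ : ∀ i, DifferentiableAt ℝ (fun w => φ w i) z)
    (hf : DifferentiableAt ℝ f z) (tφ : ∀ i, φ z i ∈ V01 n) :
    dAlong Sum.inl (fun w => contrLoc (φ w) (f w)) z - contrLoc (φ z) (dAlong Sum.inl f z)
      = lieLoc φ f z := by
  have h1 : ∀ i k, φ z i * contr i (cov (Sum.inl k) * wirt (Sum.inl k) f z)
      = (if k = i then φ z i * wirt (Sum.inl k) f z else 0)
        + cov (Sum.inl k) * (φ z i * contr i (wirt (Sum.inl k) f z)) := by
    intro i k
    have := cov_mul_of_mem (Sum.inl k) 1 (by simpa using tφ i)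
    rw [contr_cov_mul, mul_sub, ← mul_assoc, ← mul_assoc, this]
    simp [apply_ite (φ z i * ·), sub_eq_add_neg]
  simp only [lieLoc, dAlong, wirt_contrLoc _ hφ hf]
  simp only [contrLoc, map_sum, Finset.mul_sum, h1, mul_add, Finset.sum_add_distrib,
    Finset.sum_ite_eq', Finset.mem_univ, if_true, Finset.sum_sub_distrib, Finset.sum_mul,
    mul_assoc]
  rw [Finset.sum_comm, Finset.sum_comm (f := fun i k => cov (Sum.inl i) * (φ z k * _))]
  abel

/-- The derivatives of `f` cancel, so the commutator acts on `f` by contraction only. What survives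
is `∂ᵢψʲ`, from differentiating the coefficients of `ψ`, and `∂ⱼφⁱ`, from contracting `∂φⁱ` with
`∂/∂zʲ`. The type of `φ` is needed at all points because its derivatives must also have type
`(0,1)`. -/
lemma lieLoc_contrLoc (hφ : ∀ i, DifferentiableAt ℝ (fun w => φ w i) z)
    (hψ : ∀ i, DifferentiableAt ℝ (fun w => ψ w i) z) (hf : DifferentiableAt ℝ f z)
    (tφ : ∀ w i, φ w i ∈ V01 n) (tψ : ∀ i, ψ z i ∈ V01 n) :
    lieLoc φ (fun w => contrLoc (ψ w) (f w)) z - contrLoc (ψ z) (lieLoc φ f z)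
      = -contrLoc (bracketLoc φ ψ z) (f z) := by
  have tw : ∀ k i, wirt (Sum.inl k) (fun w => φ w i) z ∈ V01 n := fun k i =>
    wirt_mem _ _ (hφ i) (Filter.Eventually.of_forall fun w => tφ w i)
  have h1 : ∀ i u, u ∈ V01 n → dAlong Sum.inl (fun w => φ w i) z * u
      = u * dAlong Sum.inl (fun w => φ w i) z := by
    intro i u hu
    simp only [dAlong, Finset.sum_mul, Finset.mul_sum]
    refine Finset.sum_congr rfl fun k _ => ?_
    have := cov_mul_of_mem (Sum.inl k) 1 (by simpa using hu)
    rw [mul_assoc, V01_anticomm (tw k i) hu, mul_neg, ← mul_assoc, this]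
    simp [mul_assoc]
  -- The form `∂φⁱ = ∑ₖ dzᵏ ∧ ∂ₖφⁱ` has even degree, and `∂/∂zʲ ⌟ ∂φⁱ = ∂ⱼφⁱ` because `∂ₖφⁱ` is a
  -- combination of the `dz̄`.
  have h2 : ∀ i j x, contr j (dAlong Sum.inl (fun w => φ w i) z * x)
      = wirt (Sum.inl j) (fun w => φ w i) z * x
        + dAlong Sum.inl (fun w => φ w i) z * contr j x := by
    intro i j x
    simp only [dAlong, Finset.sum_mul, map_sum]
    simp only [mul_assoc, contr_cov_mul, contr_V01_mul j (tw _ i), mul_neg, sub_neg_eq_add,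
      Finset.sum_add_distrib, Sum.inl.injEq, Finset.sum_ite_eq', Finset.mem_univ, if_true]
  have h3 : ∀ i j, dAlong Sum.inl (fun w => φ w i) z * contr i (ψ z j * contr j (f z))
        - ψ z j * (dAlong Sum.inl (fun w => φ w i) z * contr j (contr i (f z))) = 0 := by
    intro i j
    rw [contr_V01_mul i (tψ j), contr_contr j i, mul_neg, mul_neg, mul_neg, ← mul_assoc,
      ← mul_assoc, h1 i _ (tψ j)]
    abel
  have h4 : ∀ i j, φ z i * (ψ z j * contr j (wirt (Sum.inl i) f z))
      = ψ z j * contr j (φ z i * wirt (Sum.inl i) f z) := by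
    intro i j
    rw [contr_V01_mul j (tφ z i), ← mul_assoc, V01_anticomm (tφ z i) (tψ j)]
    simp [mul_assoc]
  -- The `(i,j)` summand of the commutator: `h3` cancels the double contractions and `h4` the
  -- derivatives of `f`.
  have h5 : ∀ i j, dAlong Sum.inl (fun w => φ w i) z * contr i (ψ z j * contr j (f z))
      - φ z i * (wirt (Sum.inl i) (fun w => ψ w j) z * contr j (f z)
        + ψ z j * contr j (wirt (Sum.inl i) f z))
      - ψ z j * contr j (dAlong Sum.inl (fun w => φ w i) z * contr i (f z)
        - φ z i * wirt (Sum.inl i) f z)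
      = -(φ z i * wirt (Sum.inl i) (fun w => ψ w j) z * contr j (f z))
        - ψ z j * wirt (Sum.inl j) (fun w => φ w i) z * contr i (f z) := by
    intro i j
    have := h3 i j
    rw [sub_eq_zero] at this
    rw [map_sub, mul_sub, h2, mul_add, mul_add, h4, this]
    simp only [mul_assoc]
    abel
  have e : lieLoc φ (fun w => contrLoc (ψ w) (f w)) z - contrLoc (ψ z) (lieLoc φ f z)
      = ∑ i, ∑ j, (dAlong Sum.inl (fun w => φ w i) z * contr i (ψ z j * contr j (f z))
      - φ z i * (wirt (Sum.inl i) (fun w => ψ w j) z * contr j (f z)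
        + ψ z j * contr j (wirt (Sum.inl i) f z))
      - ψ z j * contr j (dAlong Sum.inl (fun w => φ w i) z * contr i (f z)
        - φ z i * wirt (Sum.inl i) f z)) := by
    simp only [lieLoc, wirt_contrLoc _ hψ hf]
    simp only [contrLoc, map_sum, Finset.mul_sum, Finset.sum_sub_distrib]
    congr 1
    conv_rhs => rw [Finset.sum_comm]
    simp only [← Finset.sum_sub_distrib, map_sum, Finset.mul_sum]
  rw [e]
  simp only [h5, contrLoc, bracketLoc, Finset.sum_add_distrib, Finset.sum_mul,
    add_mul, Finset.sum_sub_distrib, Finset.sum_neg_distrib, neg_add]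
  rw [← sub_eq_add_neg]
  congr 1
  rw [Finset.sum_comm]

end

/-! ### Global identities -/

section Manifold

variable {M : Type*} [TopologicalSpace M] [ChartedSpace (Fin n → ℂ) M]

lemma VForm.mem_V01_pow {q : ℕ} (φ : VForm n M q) (c : atlas (Fin n → ℂ) M) (z : Fin n → ℂ)
    (j : Fin n) : φ.val c z j ∈ V01 n ^ q := by
  have := φ.type c j z
  rwa [bideg_zero_natCast] at this

lemma VForm.mem_V01 (φ : VForm n M 1) (c : atlas (Fin n → ℂ) M) (z : Fin n → ℂ) (j : Fin n) :
    φ.val c z j ∈ V01 n := by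
  simpa using φ.mem_V01_pow c z j

variable [IsManifold 𝓘(ℂ, Fin n → ℂ) ω M]

lemma del_val (α : Form n M) (c : atlas (Fin n → ℂ) M) {z : Fin n → ℂ} (hz : z ∈ c.1.target) :
    (del α).val c z = dAlong Sum.inl (α.val c) z := Set.indicator_of_mem hz _

lemma contrForm_val {q : ℕ} (φ : VForm n M q) (α : Form n M) (c : atlas (Fin n → ℂ) M) :
    (contrForm q φ α).val c = fun z => contrLoc (φ.val c z) (α.val c z) := rfl

lemma bracket_val (φ ψ : VForm n M 1) (c : atlas (Fin n → ℂ) M) {z : Fin n → ℂ}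
    (hz : z ∈ c.1.target) :
    (bracket φ ψ).val c z = bracketLoc (φ.val c) (ψ.val c) z := Set.indicator_of_mem hz _

lemma contrForm_comm {q : ℕ} (φ : VForm n M 1) (σ : VForm n M q) :
    Commute (contrForm q σ) (contrForm 1 φ) :=
  LinearMap.ext fun _ => Form.ext_target fun c z _ =>
    contrLoc_comm (φ.mem_V01 c z) (σ.mem_V01_pow c z) _

/-- The commutator of `∂` and `i_φ`. -/
def lieForm (φ : VForm n M 1) : Module.End ℂ (Form n M) :=
  del * contrForm 1 φ - contrForm 1 φ * del

lemma lieForm_val (φ : VForm n M 1) (α : Form n M) (c : atlas (Fin n → ℂ) M) {z : Fin n → ℂ}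
    (hz : z ∈ c.1.target) : (lieForm φ α).val c z = lieLoc (φ.val c) (α.val c) z := by
  change (del (contrForm 1 φ α) - contrForm 1 φ (del α)).val c z = _
  rw [Form.sub_val, Pi.sub_apply, Pi.sub_apply, del_val _ c hz, contrForm_val, contrForm_val]
  beta_reduce
  rw [del_val _ c hz]
  exact del_contrLoc (fun i => φ.diff c i hz) (α.diff c hz) (φ.mem_V01 c z)

/-- `[[∂, i_φ], i_ψ] = -i_{[φ,ψ]}`. -/
lemma lieForm_mul_contrForm (φ ψ : VForm n M 1) :
    lieForm φ * contrForm 1 ψ - contrForm 1 ψ * lieForm φ = -contrForm 2 (bracket φ ψ) := by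
  refine LinearMap.ext fun α => Form.ext_target fun c z hz => ?_
  change (lieForm φ (contrForm 1 ψ α) - contrForm 1 ψ (lieForm φ α)).val c z
    = -contrLoc ((bracket φ ψ).val c z) (α.val c z)
  rw [Form.sub_val, Pi.sub_apply, Pi.sub_apply, lieForm_val _ _ c hz, contrForm_val, contrForm_val]
  beta_reduce
  rw [lieForm_val _ _ c hz, bracket_val _ _ c hz]
  exact lieLoc_contrLoc (fun i => φ.diff c i hz) (fun i => ψ.diff c i hz) (α.diff c hz)
    (φ.mem_V01 c) (ψ.mem_V01 c z)

/-- `[∂̄, i_φ] = i_{∂̄φ}`. -/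
lemma dbar_mul_contrForm (φ : VForm n M 1) :
    dbar * contrForm 1 φ - contrForm 1 φ * dbar = contrForm 2 (dbarV 1 φ) := by
  refine LinearMap.ext fun α => ?_
  change dbar (contrForm 1 φ α) - contrForm 1 φ (dbar α) = _
  rw [dbar_contrForm]
  simp

/-- `[d, i_φ] = [∂, i_φ] + i_{∂̄φ}`. -/
lemma dExt_mul_contrForm (φ : VForm n M 1) :
    dExt * contrForm 1 φ - contrForm 1 φ * dExt = lieForm φ + contrForm 2 (dbarV 1 φ) := by
  rw [← dbar_mul_contrForm, lieForm, dExt]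
  noncomm_ring

end Manifold

end Frolicher

namespace Frolicher

variable {n : ℕ}

/-! ### The bigrading of the exterior algebra -/

lemma cov_inl_mul_mem (i : Fin n) {p q : ℤ} {x : Lam n} (hx : x ∈ bideg n p q) :
    cov (Sum.inl i) * x ∈ bideg n (p + 1) q := by
  by_cases h : 0 ≤ p ∧ 0 ≤ q
  · obtain ⟨⟨a, rfl⟩, ⟨b, rfl⟩⟩ := And.imp Int.eq_ofNat_of_zero_le Int.eq_ofNat_of_zero_le h
    rw [bideg_natCast] at hx
    have := bideg_natCast (n := n) (a + 1) b
    push_cast at this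
    rw [this, pow_succ', mul_assoc]
    exact Submodule.mul_mem_mul (Submodule.subset_span ⟨i, rfl⟩) hx
  · rw [bideg_of_neg h, Submodule.mem_bot] at hx
    simp [hx]

lemma cov_inr_mul_mem (i : Fin n) {p q : ℤ} {x : Lam n} (hx : x ∈ bideg n p q) :
    cov (Sum.inr i) * x ∈ bideg n p (q + 1) := by
  by_cases h : 0 ≤ p ∧ 0 ≤ q
  · obtain ⟨⟨a, rfl⟩, ⟨b, rfl⟩⟩ := And.imp Int.eq_ofNat_of_zero_le Int.eq_ofNat_of_zero_le h
    rw [bideg_natCast] at hx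
    have := bideg_natCast (n := n) a (b + 1)
    push_cast at this
    rw [this, pow_succ', ← mul_assoc,
      ← ((show Commute (V01 n) (V10 n) from V01_mul_V10).pow_right a).eq, mul_assoc]
    exact Submodule.mul_mem_mul (Submodule.subset_span ⟨i, rfl⟩) hx
  · rw [bideg_of_neg h, Submodule.mem_bot] at hx
    simp [hx]

/-- The algebra endomorphism with `dzⁱ ↦ 2 dzⁱ` and `dz̄ⁱ ↦ dz̄ⁱ`. -/
def scale (n : ℕ) : Lam n →ₐ[ℂ] Lam n :=
  ExteriorAlgebra.map (LinearMap.pi fun a : Ix n =>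
    (Sum.elim (fun _ => (2 : ℂ)) (fun _ => 1) a) • LinearMap.proj a)

lemma scale_cov (a : Ix n) :
    scale n (cov a) = (Sum.elim (fun _ => (2 : ℂ)) (fun _ => 1) a) • cov a := by
  rw [scale, cov, ExteriorAlgebra.map_apply_ι, ← map_smul]
  congr 1
  ext b
  by_cases h : b = a
  · subst h; simp
  · simp [h]

lemma apply_eq_smul_of_mem_pow {A : Type*} [Ring A] [Algebra ℂ A] (T : A →ₐ[ℂ] A)
    {S : Submodule ℂ A} {c : ℂ} (hS : ∀ x ∈ S, T x = c • x) (k : ℕ) {x : A} (hx : x ∈ S ^ k) :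
    T x = c ^ k • x := by
  induction k generalizing x with
  | zero =>
    rw [pow_zero, Submodule.mem_one] at hx
    obtain ⟨r, rfl⟩ := hx
    simp
  | succ k ih =>
    rw [pow_succ'] at hx
    induction hx using Submodule.mul_induction_on' with
    | add x _ y _ hx hy => rw [map_add, hx, hy, smul_add]
    | mem_mul_mem u hu v hv =>
      rw [map_mul, hS u hu, ih hv, smul_mul_smul_comm, pow_succ']

lemma scale_of_mem_span {ι : Type*} (g : ι → Ix n) {c : ℂ}
    (hg : ∀ i, Sum.elim (fun _ => (2 : ℂ)) (fun _ => 1) (g i) = c) {x : Lam n}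
    (hx : x ∈ Submodule.span ℂ (Set.range fun i => cov (g i))) : scale n x = c • x := by
  induction hx using Submodule.span_induction with
  | mem x hx => obtain ⟨i, rfl⟩ := hx; rw [scale_cov, hg]
  | zero => simp
  | add x y _ _ hx hy => rw [map_add, hx, hy, smul_add]
  | smul c x _ hx => rw [map_smul, hx, smul_comm]

/-- The holomorphic degree is detected by the eigenvalue of `scale`, so that independence of
eigenspaces separates types with different `p` without choosing a basis of the exterior algebra. -/
lemma bideg_le_eigenspace (p q : ℤ) :
    bideg n p q ≤ Module.End.eigenspace (scale n).toLinearMap ((2 : ℂ) ^ p) := by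
  intro x hx
  rw [Module.End.mem_eigenspace_iff]
  by_cases h : 0 ≤ p ∧ 0 ≤ q
  · obtain ⟨⟨a, rfl⟩, ⟨b, rfl⟩⟩ := And.imp Int.eq_ofNat_of_zero_le Int.eq_ofNat_of_zero_le h
    rw [bideg_natCast] at hx
    change scale n x = _
    rw [zpow_natCast]
    induction hx using Submodule.mul_induction_on' with
    | add x _ y _ hx hy => rw [map_add, hx, hy, smul_add]
    | mem_mul_mem u hu v hv =>
      rw [map_mul, apply_eq_smul_of_mem_pow _
          (fun x hx => scale_of_mem_span (c := 2) Sum.inl (fun _ => rfl) hx) a hu,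
        apply_eq_smul_of_mem_pow _
          (fun x hx => scale_of_mem_span (c := 1) Sum.inr (fun _ => rfl) hx) b hv, one_pow, one_smul,
        smul_mul_assoc]
  · rw [bideg_of_neg h, Submodule.mem_bot] at hx
    simp [hx]

lemma disjoint_bideg (p q k : ℤ) :
    Disjoint (bideg n p q) (⨆ (l : ℤ) (_ : p + 1 ≤ l), bideg n l (k - l)) := by
  refine (Module.End.eigenspaces_iSupIndep (scale n).toLinearMap ((2 : ℂ) ^ p)).mono
    (bideg_le_eigenspace p q) (iSup₂_le fun l hl => ?_)
  have h : (2 : ℂ) ^ l ≠ 2 ^ p := by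
    intro h
    -- Norms transfer the equation to the reals, where integer powers of `2` are distinct.
    have h' : (2 : ℝ) ^ l = 2 ^ p := by
      have := congrArg norm h
      simpa using this
    have := zpow_right_injective₀ (by norm_num) (by norm_num) h'
    omega
  exact (bideg_le_eigenspace l (k - l)).trans (le_iSup₂_of_le _ h le_rfl)

section Manifold

variable {M : Type*} [TopologicalSpace M] [ChartedSpace (Fin n → ℂ) M]
  [IsManifold 𝓘(ℂ, Fin n → ℂ) ω M]

/-! ### The bigrading and the filtration on forms -/

/-- Differentiating coefficients keeps values in the same subspace, so the type changes only through
multiplication by the coframe. -/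
lemma dForm_mem_Apq {g : Fin n → Ix n} (hg : g = Sum.inl ∨ g = Sum.inr) {p q p' q' : ℤ}
    (h : ∀ i, ∀ x ∈ bideg n p q, cov (g i) * x ∈ bideg n p' q') {α : Form n M}
    (hα : α ∈ Apq p q) : dForm g hg α ∈ Apq p' q' := by
  intro c z
  change c.1.target.indicator (dAlong g (α.val c)) z ∈ _
  by_cases hz : z ∈ c.1.target
  · rw [Set.indicator_of_mem hz]
    exact Submodule.sum_mem _ fun i _ => h i _ <|
      wirt_mem _ _ (α.diff c hz) (Filter.Eventually.of_forall fun w => hα c w)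
  · rw [Set.indicator_of_notMem hz]
    exact zero_mem _

lemma del_mem {p q : ℤ} {α : Form n M} (hα : α ∈ Apq p q) : del α ∈ Apq (p + 1) q :=
  dForm_mem_Apq _ (fun i _ => cov_inl_mul_mem i) hα

lemma dbar_mem {p q : ℤ} {α : Form n M} (hα : α ∈ Apq p q) : dbar α ∈ Apq p (q + 1) :=
  dForm_mem_Apq _ (fun i _ => cov_inr_mul_mem i) hα

lemma Apq_eq_bot {p q : ℤ} (h : ¬ (0 ≤ p ∧ 0 ≤ q)) : Apq (n := n) (M := M) p q = ⊥ := by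
  refine (Submodule.eq_bot_iff _).2 fun α hα => Form.ext_target fun c z _ => ?_
  have := hα c z
  rwa [bideg_of_neg h, Submodule.mem_bot] at this

lemma Apq_le_Fil {m l r k : ℤ} (h : m ≤ l) (e : l + r = k) :
    Apq (n := n) (M := M) l r ≤ Fil m k := by
  obtain rfl : r = k - l := by omega
  exact le_iSup₂_of_le l h le_rfl

lemma Fil_mono {l m : ℤ} (h : l ≤ m) (k : ℤ) : Fil (n := n) (M := M) m k ≤ Fil l k :=
  iSup₂_le fun j hj => Apq_le_Fil (h.trans hj) (by omega)

/-- If `j > k`, then `k - j < 0` and there are no forms of type `(j,k-j)`. This boundedness of the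
filtration ends the iteration in `exists_dExt_eq_step`. -/
lemma Fil_eq_bot {l k : ℤ} (h : k < l) : Fil (n := n) (M := M) l k = ⊥ :=
  le_bot_iff.1 <| iSup₂_le fun j hj => (Apq_eq_bot (by omega)).le

/-- Types with negative first degree are zero, so `F^0` contains every step of the filtration. It
serves as the space of all forms of degree `k`, which even the operators `i_φ` preserve. -/
lemma Fil_le_Fil_zero (l k : ℤ) : Fil (n := n) (M := M) l k ≤ Fil 0 k := by
  refine iSup₂_le fun j hj => ?_
  by_cases h : 0 ≤ j
  · exact Apq_le_Fil h (by omega)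
  · rw [Apq_eq_bot (by omega)]
    exact bot_le

lemma Fil_le_sup (l k : ℤ) : Fil (n := n) (M := M) l k ≤ Apq l (k - l) ⊔ Fil (l + 1) k := by
  refine iSup₂_le fun j hj => ?_
  rcases hj.eq_or_lt with rfl | hj
  · exact le_sup_left
  · exact (Apq_le_Fil hj (by omega)).trans le_sup_right

lemma disjoint_Apq_Fil (p q k : ℤ) : Disjoint (Apq (n := n) (M := M) p q) (Fil (p + 1) k) := by
  rw [Submodule.disjoint_def]
  intro α hα hF
  have key : ∀ β ∈ Fil (n := n) (M := M) (p + 1) k, ∀ c z,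
      β.val c z ∈ ⨆ (l : ℤ) (_ : p + 1 ≤ l), bideg n l (k - l) := by
    intro β hβ c z
    let ev : Form n M →ₗ[ℂ] Lam n :=
      { toFun := fun β => β.val c z, map_add' := fun _ _ => rfl, map_smul' := fun _ _ => rfl }
    have : Fil (n := n) (M := M) (p + 1) k ≤
        (⨆ (l : ℤ) (_ : p + 1 ≤ l), bideg n l (k - l)).comap ev := iSup₂_le fun l hl β hβ =>
      (le_iSup₂_of_le (f := fun (l : ℤ) (_ : p + 1 ≤ l) => bideg n l (k - l)) l hl le_rfl) (hβ c z)
    exact this hβ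
  exact Form.ext_target fun c z _ =>
    (Submodule.disjoint_def.1 (disjoint_bideg p q k)) _ (hα c z) (key α hF c z)

/-- The shift of the filtration under a linear operator can be checked on forms of pure type. -/
lemma map_mem_Fil {T : Module.End ℂ (Form n M)} {a b : ℤ}
    (hT : ∀ p q α, α ∈ Apq p q → T α ∈ Fil (p + a) (p + q + b)) {l k : ℤ} {α : Form n M}
    (hα : α ∈ Fil l k) : T α ∈ Fil (l + a) (k + b) := by
  have : Fil l k ≤ (Fil (l + a) (k + b)).comap T := iSup₂_le fun j hj β hβ => by
    have := hT _ _ β hβ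
    rw [add_sub_cancel] at this
    exact Fil_mono (by omega) _ this
  exact this hα

lemma dExt_mem_Fil {l k : ℤ} {α : Form n M} (hα : α ∈ Fil l k) : dExt α ∈ Fil l (k + 1) := by
  have := map_mem_Fil (T := dExt) (a := 0) (b := 1) (fun p q α hα => add_mem
    (Apq_le_Fil (by omega) (by omega) (del_mem hα))
    (Apq_le_Fil (by omega) (by omega) (dbar_mem hα))) hα
  rwa [add_zero] at this

lemma contrForm_mem_Fil {r : ℕ} (φ : VForm n M r) {l k : ℤ} {α : Form n M} (hα : α ∈ Fil l k) :
    contrForm r φ α ∈ Fil (l - 1) (k + r - 1) := by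
  have := map_mem_Fil (T := contrForm r φ) (a := -1) (b := r - 1) (fun p q α hα =>
    Apq_le_Fil (by omega) (by omega) (contrForm_mem φ hα)) hα
  rwa [← sub_eq_add_neg, ← add_sub_assoc] at this

/-- In the commutator, `∂` raises the first degree by one and `i_φ` lowers it by one. The result has
bidegree `(0,1)` and so preserves the filtration, whereas `i_φ` alone loses a step. -/
lemma lieForm_mem_Fil (φ : VForm n M 1) {l k : ℤ} {α : Form n M} (hα : α ∈ Fil l k) :
    lieForm φ α ∈ Fil l (k + 1) := by
  have := map_mem_Fil (T := lieForm φ) (a := 0) (b := 1) (fun p q α hα => sub_mem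
    (Apq_le_Fil (by omega) (by push_cast; omega) (del_mem (contrForm_mem φ hα)))
    (Apq_le_Fil (by omega) (by push_cast; omega) (contrForm_mem φ (del_mem hα)))) hα
  rwa [add_zero] at this

/-! ### Strictness of the exterior derivative -/

/-- Vanishing of `d_r` on the class of `η` means `dη = y + dv` with `y ∈ Z_{r-1}^{l+r+1,q-r}` and `v
∈ F^{l+1}`. Subtracting `v` therefore pushes the differential one step further into the filtration.
-/
lemma exists_dExt_of_dr_eq_zero {r l q : ℤ} (hd : dr n M r l q = 0) {η : Form n M}
    (hη : η ∈ Fil l (l + q)) (hdη : dExt η ∈ Fil (l + r) (l + q + 1)) :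
    ∃ v ∈ Fil (l + 1) (l + q), dExt (η - v) ∈ Fil (n := n) (M := M) (l + r + 1) (l + q + 1) := by
  have h := LinearMap.congr_fun hd (Submodule.Quotient.mk ⟨η, hη, hdη⟩)
  have h' := (Submodule.Quotient.mk_eq_zero _).1 h
  obtain ⟨y, hy, w, ⟨hw, v, hv, rfl⟩, e⟩ := Submodule.mem_sup.1 h'
  replace e : y + dExt v = dExt η := e
  refine ⟨v, ?_, ?_⟩
  · change v ∈ Fil _ _ at hv
    rwa [show l + r - (r - 1) = l + 1 by ring, show l + r + (q - r + 1) - 1 = l + q by ring] at hv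
  · have hy' : y ∈ Fil _ _ := hy.1
    rw [map_sub, ← e, add_sub_cancel_right]
    rwa [show l + r + 1 + (q - r + 1 - 1) = l + q + 1 by ring] at hy'

/-- If all differentials from `F^l` to `F^m` vanish for a given `l`, then an element of `F^l` with
differential in `F^m` can be replaced by an element of `F^{l+1}` with the same differential. -/
lemma exists_dExt_eq_step {l m k : ℤ}
    (h : ∀ r, m - l ≤ r → dr n M r l (k - l) = 0) {η : Form n M} (hη : η ∈ Fil l k)
    (hdη : dExt η ∈ Fil m (k + 1)) : ∃ v ∈ Fil (l + 1) k, dExt v = dExt η := by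
  -- The corrected form still lies in `F^l` and its differential in `F^{m+j}`, so `d_r` with `r = m
  -- - l + j` supplies the next correction.
  have key : ∀ j : ℕ, ∃ v ∈ Fil (l + 1) k, dExt (η - v) ∈ Fil (m + j) (k + 1) := by
    intro j
    induction j with
    | zero => exact ⟨0, zero_mem _, by simpa using hdη⟩
    | succ j ih =>
      obtain ⟨v, hv, hdv⟩ := ih
      obtain ⟨w, hw, hdw⟩ := exists_dExt_of_dr_eq_zero (h (m - l + j) (by omega))
        (η := η - v) (by rw [add_sub_cancel]; exact sub_mem hη (Fil_mono (by omega) _ hv))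
        (by rwa [add_sub_cancel, show l + (m - l + j) = m + j by ring])
      rw [add_sub_cancel] at hw hdw
      refine ⟨v + w, add_mem hv hw, ?_⟩
      rw [← sub_sub]
      convert hdw using 2
      push_cast; ring
  -- For this `j` one has `m + j ≥ k + 2`, and `F^{m+j} A^{k+1} = 0`; hence `d(η - v)` vanishes.
  obtain ⟨v, hv, hdv⟩ := key (k + 2 - m).toNat
  refine ⟨v, hv, ?_⟩
  rw [Fil_eq_bot (by have := Int.self_le_toNat (k + 2 - m); omega), Submodule.mem_bot,
    map_sub, sub_eq_zero] at hdv
  exact hdv.symm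

/-- Strictness of `d`: the primitive climbs from `F^l` to `F^m` one step at a time by
`exists_dExt_eq_step`. At level `l` only the differentials with `r ≥ m - l` are needed, since the
differential already lies in `F^m`. -/
lemma exists_dExt_eq {m k : ℤ} (h : ∀ l r, l < m → m - l ≤ r → dr n M r l (k - l) = 0) {l : ℤ}
    {η : Form n M} (hη : η ∈ Fil l k) (hdη : dExt η ∈ Fil m (k + 1)) :
    ∃ v ∈ Fil m k, dExt v = dExt η := by
  have key : ∀ j : ℕ, l + j ≤ m → ∃ v ∈ Fil (l + j) k, dExt v = dExt η := by
    intro j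
    induction j with
    | zero => exact fun _ => ⟨η, by simpa using hη, rfl⟩
    | succ j ih =>
      intro hj
      push_cast at hj
      obtain ⟨v, hv, e⟩ := ih (by omega)
      obtain ⟨w, hw, e'⟩ := exists_dExt_eq_step (l := l + j) (m := m)
        (fun r hr => h _ r (by omega) hr) hv (e ▸ hdη)
      exact ⟨w, by convert hw using 2; push_cast; ring, e'.trans e⟩
  rcases le_total l m with hlm | hlm
  · obtain ⟨v, hv, e⟩ := key (m - l).toNat (by rw [Int.toNat_of_nonneg] <;> omega)
    rw [Int.toNat_of_nonneg (by omega), add_sub_cancel] at hv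
    exact ⟨v, hv, e⟩
  · exact ⟨η, Fil_mono hlm _ hη, rfl⟩

end Manifold

end Frolicher

namespace Frolicher

/-! ### Conjugation by an exponential power series -/

section PowerSeriesExp

variable {R : Type*} [Ring R] [Algebra ℂ R]

/-- The divided power `Aᵐ/m!`. -/
def divPow (A : R) (m : ℕ) : R := (1 / (m.factorial : ℂ)) • A ^ m

lemma divPow_mul (A : R) (m : ℕ) : divPow A m * A = ((m : ℂ) + 1) • divPow A (m + 1) := by
  have : ((m : ℂ) + 1) ≠ 0 := by exact_mod_cast m.succ_ne_zero
  rw [divPow, divPow, smul_mul_assoc, ← pow_succ, smul_smul, Nat.factorial_succ]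
  congr 1
  push_cast
  field_simp

/-- If the double commutator `C₂` of `d` and `A` commutes with `A`, then the conjugation of `d` by
`exp A` has only three terms. -/
lemma mul_divPow {d A C₁ C₂ : R} (h₁ : d * A = A * d + C₁) (h₂ : C₁ * A = A * C₁ + C₂)
    (h₃ : C₂ * A = A * C₂) (m : ℕ) :
    d * divPow A (m + 2) = divPow A (m + 2) * d + divPow A (m + 1) * C₁
      + (1 / 2 : ℂ) • (divPow A m * C₂) := by
  induction m with
  | zero =>
    have e : d * (A * A) = A * A * d + (2 : ℂ) • (A * C₁) + C₂ := by
      rw [← mul_assoc, h₁, add_mul, mul_assoc A d A, h₁, h₂, mul_add, two_smul, ← mul_assoc]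
      abel
    simp only [divPow, zero_add, Nat.factorial, pow_two, pow_one, pow_zero, mul_smul_comm, e]
    simp only [smul_mul_assoc, smul_add, one_mul]
    module
  | succ m ih =>
    have hm : ((m : ℂ) + 3) ≠ 0 := by exact_mod_cast (m + 2).succ_ne_zero
    have e : ∀ k, divPow A (k + 1) = (1 / ((k : ℂ) + 1)) • (divPow A k * A) := by
      intro k
      have : ((k : ℂ) + 1) ≠ 0 := by exact_mod_cast k.succ_ne_zero
      rw [divPow_mul, smul_smul, one_div, inv_mul_cancel₀ this, one_smul]
    -- The induction hypothesis is multiplied by `A` on the right, and `A` is moved to the left past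
    -- `d`, `C₁`, `C₂`. Collecting divided powers gives the factor `1 + (m+2) = m+3` for `C₁` and `1
    -- + ½(m+1) = ½(m+3)` for `C₂`; the prefactor `1/(m+3)` cancels both.
    have e1 : d * (divPow A (m + 2) * A) = divPow A (m + 2) * A * d + divPow A (m + 2) * C₁
        + divPow A (m + 1) * A * C₁ + divPow A (m + 1) * C₂
        + (1 / 2 : ℂ) • (divPow A m * A * C₂) := by
      rw [← mul_assoc, ih, add_mul, add_mul, mul_assoc _ d A, h₁, mul_assoc _ C₁ A, h₂,
        smul_mul_assoc, mul_assoc _ C₂ A, h₃]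
      simp only [mul_add, mul_assoc]
      abel
    rw [e (m + 2), mul_smul_comm, e1, divPow_mul, divPow_mul, divPow_mul]
    simp only [smul_mul_assoc, smul_add, smul_smul]
    push_cast
    rw [show (m : ℂ) + 2 + 1 = m + 3 by ring]
    match_scalars <;> field_simp <;> ring

open PowerSeries

/-- The coefficients of the exponential of a power series without constant term, up to order
`K`. -/
def expCoeff (K : ℕ) (A : PowerSeries R) (k : ℕ) : R :=
  coeff k (∑ m ∈ Finset.range (K + 1), divPow A m)

/-- A series without constant term is divisible by the central element `X`, so its `m`-th power is
divisible by `Xᵐ`. Thus truncating the exponential does not affect low-order coefficients. -/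
lemma coeff_divPow_mul {A : PowerSeries R} (hA : coeff 0 A = 0) {k m : ℕ} (h : k < m)
    (B : PowerSeries R) : coeff k (divPow A m * B) = 0 := by
  obtain ⟨A', rfl⟩ : ∃ A', A = X * A' := by
    refine ⟨mk fun k => coeff (k + 1) A, ext fun k => ?_⟩
    rcases k with _ | k
    · simpa using hA
    · rw [coeff_succ_X_mul, coeff_mk]
  have : (X * A' : PowerSeries R) ^ m = X ^ m * A' ^ m := (commute_X A').symm.mul_pow m
  rw [divPow, this, smul_mul_assoc, mul_assoc, coeff_smul, coeff_X_pow_mul', if_neg (by omega),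
    smul_zero]

lemma expCoeff_zero {A : PowerSeries R} (hA : coeff 0 A = 0) (K : ℕ) : expCoeff K A 0 = 1 := by
  rw [expCoeff, Finset.sum_range_succ', map_add, map_sum, Finset.sum_eq_zero fun m _ => ?_]
  · simp [divPow]
  · simpa using coeff_divPow_mul hA m.succ_pos 1

/-- The coefficients of the exponential are noncommutative polynomials in the coefficients of `A`;
any subalgebra containing the latter contains the former. -/
lemma expCoeff_mem {A : PowerSeries R} (S : Subalgebra ℂ R) (h : ∀ k, coeff k A ∈ S) (K k : ℕ) :
    expCoeff K A k ∈ S := by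
  have hp : ∀ m k, coeff k (A ^ m) ∈ S := by
    intro m
    induction m with
    | zero =>
      intro k
      rw [pow_zero, coeff_one]
      split_ifs
      exacts [one_mem _, zero_mem _]
    | succ m ih =>
      intro k
      rw [pow_succ, coeff_mul]
      exact sum_mem fun x _ => mul_mem (ih _) (h _)
  rw [expCoeff, map_sum]
  refine sum_mem fun m _ => ?_
  rw [divPow, coeff_smul]
  exact S.smul_mem (hp m k) _

/-- This is `d exp(A) = exp(A) (d + C₁ + ½ C₂)` coefficientwise. Commuting `d` past the truncated
exponential yields truncations of lengths `K+2`, `K+1` and `K` in front of the three terms. They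
agree up to order `K` because the extra powers of `A` start at order `K+1`. -/
lemma mul_expCoeff {d : R} {A C₁ C₂ : PowerSeries R} (hA : coeff 0 A = 0)
    (h₁ : C d * A = A * C d + C₁) (h₂ : C₁ * A = A * C₁ + C₂) (h₃ : C₂ * A = A * C₂) {K k : ℕ}
    (hk : k ≤ K) :
    d * expCoeff (K + 2) A k = ∑ x ∈ Finset.HasAntidiagonal.antidiagonal k,
      expCoeff (K + 2) A x.1 * coeff x.2 (C d + C₁ + (1 / 2 : ℂ) • C₂) := by
  have e0 : ∀ j, (∑ m ∈ Finset.range (j + 2 + 1), divPow A m)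
      = 1 + A + ∑ m ∈ Finset.range (j + 1), divPow A (m + 2) := by
    intro j
    rw [Finset.sum_range_succ', Finset.sum_range_succ']
    simp only [divPow, pow_zero, zero_add, pow_one, Nat.factorial]
    simp only [Nat.cast_one, mul_one, div_one, one_smul]
    abel
  have e1 : (∑ m ∈ Finset.range (K + 2), divPow A m)
      = 1 + ∑ m ∈ Finset.range (K + 1), divPow A (m + 1) := by
    rw [Finset.sum_range_succ']
    simp [divPow, add_comm]
  have main : C d * (∑ m ∈ Finset.range (K + 2 + 1), divPow A m)
      = (∑ m ∈ Finset.range (K + 2 + 1), divPow A m) * C d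
        + (∑ m ∈ Finset.range (K + 2), divPow A m) * C₁
        + (1 / 2 : ℂ) • ((∑ m ∈ Finset.range (K + 1), divPow A m) * C₂) := by
    rw [e0, e1]
    simp only [mul_add, mul_one, Finset.mul_sum, mul_divPow h₁ h₂ h₃, Finset.sum_add_distrib,
      add_mul, one_mul, Finset.sum_mul, Finset.smul_sum, h₁]
    abel
  have hc := congrArg (coeff k) main
  rw [coeff_C_mul] at hc
  have t1 : coeff k ((∑ m ∈ Finset.range (K + 2 + 1), divPow A m) * C₁)
      = coeff k ((∑ m ∈ Finset.range (K + 2), divPow A m) * C₁) := by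
    rw [Finset.sum_range_succ, add_mul, map_add, coeff_divPow_mul hA (by omega), add_zero]
  have t2 : coeff k ((∑ m ∈ Finset.range (K + 2 + 1), divPow A m) * C₂)
      = coeff k ((∑ m ∈ Finset.range (K + 1), divPow A m) * C₂) := by
    rw [Finset.sum_range_succ, Finset.sum_range_succ, add_mul, add_mul, map_add, map_add,
      coeff_divPow_mul hA (by omega), coeff_divPow_mul hA (by omega), add_zero, add_zero]
  simp only [expCoeff]
  rw [← coeff_mul, hc, mul_add, mul_add, map_add, map_add, map_add, map_add, mul_smul_comm,
    coeff_smul, coeff_smul, t1, t2]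

end PowerSeriesExp

end Frolicher

/-- Associativity of iterated sums over antidiagonals. -/
lemma sum_antidiagonal_assoc {A : Type*} [AddCommMonoid A] (k : ℕ) (g : ℕ → ℕ → ℕ → A) :
    ∑ s ∈ Finset.HasAntidiagonal.antidiagonal k,
      ∑ t ∈ Finset.HasAntidiagonal.antidiagonal s.1, g t.1 t.2 s.2
      = ∑ s ∈ Finset.HasAntidiagonal.antidiagonal k,
        ∑ t ∈ Finset.HasAntidiagonal.antidiagonal s.2, g s.1 t.1 t.2 := by
  rw [Finset.sum_sigma', Finset.sum_sigma']
  refine Finset.sum_nbij' (fun x => ⟨(x.2.1, x.2.2 + x.1.2), (x.2.2, x.1.2)⟩)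
    (fun x => ⟨(x.1.1 + x.2.1, x.2.2), (x.1.1, x.2.1)⟩) ?_ ?_ ?_ ?_ ?_
  all_goals
    rintro ⟨⟨a, b⟩, ⟨x, y⟩⟩ h
    simp only [Finset.mem_sigma, Finset.HasAntidiagonal.mem_antidiagonal] at h
    obtain ⟨h, h'⟩ := h
    subst h'
    simp [add_assoc, ← h]

namespace Frolicher

variable {n : ℕ}

/-! ### The mixed bracket and the Jacobi identity -/

/-- The coefficient of `∂/∂zʲ` in `[σ,φ]`, for `σ` of type `(0,2)` and `φ` of type `(0,1)`. -/
def mixLoc (σ φ : (Fin n → ℂ) → Fin n → Lam n) (z : Fin n → ℂ) (j : Fin n) : Lam n :=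
  ∑ i, (σ z i * wirt (Sum.inl i) (fun w => φ w j) z - φ z i * wirt (Sum.inl i) (fun w => σ w j) z)

section

variable {U : Set (Fin n → ℂ)} {z : Fin n → ℂ} {φ ψ χ : (Fin n → ℂ) → Fin n → Lam n}

lemma wirt_bracketLoc (hU : IsOpen U) (hz : z ∈ U)
    (hφ : ∀ i, ContDiffOn ℝ ∞ (fun w => φ w i) U) (hψ : ∀ i, ContDiffOn ℝ ∞ (fun w => ψ w i) U)
    (a : Ix n) (j : Fin n) :
    wirt a (fun w => bracketLoc φ ψ w j) z
      = ∑ i, ((wirt a (fun w => φ w i) z * wirt (Sum.inl i) (fun w => ψ w j) z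
          + φ z i * wirt a (wirt (Sum.inl i) (fun w => ψ w j)) z)
        + (wirt a (fun w => ψ w i) z * wirt (Sum.inl i) (fun w => φ w j) z
          + ψ z i * wirt a (wirt (Sum.inl i) (fun w => φ w j)) z)) := by
  have d : ∀ {f : (Fin n → ℂ) → Lam n}, ContDiffOn ℝ ∞ f U → DifferentiableAt ℝ f z := fun hf =>
    (hf.contDiffAt (hU.mem_nhds hz)).differentiableAt (by simp)
  have h1 := fun i => wirt_mul a (d (hφ i)) (d (contDiffOn_wirt (Sum.inl i) hU (hψ j)))
  have h2 := fun i => wirt_mul a (d (hψ i)) (d (contDiffOn_wirt (Sum.inl i) hU (hφ j)))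
  simp only [bracketLoc]
  rw [wirt_sum _ _ fun i _ => (h1 i).1.fun_add (h2 i).1]
  refine Finset.sum_congr rfl fun i _ => ?_
  rw [wirt_add _ (h1 i).1 (h2 i).1, (h1 i).2, (h2 i).2]

/-- `∂̄` commutes with the coefficient derivatives `∂ᵢ`, and passing `φⁱ` or `ψⁱ` costs a sign. This
is the minus sign in `mixLoc`. -/
lemma dbar_bracketLoc (hU : IsOpen U) (hz : z ∈ U)
    (hφ : ∀ i, ContDiffOn ℝ ∞ (fun w => φ w i) U) (hψ : ∀ i, ContDiffOn ℝ ∞ (fun w => ψ w i) U)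
    (tφ : ∀ i, φ z i ∈ V01 n) (tψ : ∀ i, ψ z i ∈ V01 n) (j : Fin n) :
    dAlong Sum.inr (fun w => bracketLoc φ ψ w j) z
      = mixLoc (fun w i => dAlong Sum.inr (fun w => φ w i) w) ψ z j
        + mixLoc (fun w i => dAlong Sum.inr (fun w => ψ w i) w) φ z j := by
  have hc : ∀ k u, u ∈ V01 n → ∀ x : Lam n, cov (Sum.inr k) * (u * x)
      = -(u * (cov (Sum.inr k) * x)) := by
    intro k u hu x
    have := cov_mul_of_mem (Sum.inr k) 1 (by simpa using hu)
    rw [← mul_assoc, this]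
    simp [mul_assoc]
  have hw : ∀ {χ : (Fin n → ℂ) → Fin n → Lam n}, (∀ i, ContDiffOn ℝ ∞ (fun w => χ w i) U) → ∀ i,
      wirt (Sum.inl i) (fun w => dAlong Sum.inr (fun w => χ w j) w) z
        = ∑ k, cov (Sum.inr k) * wirt (Sum.inr k) (wirt (Sum.inl i) (fun w => χ w j)) z := by
    intro χ hχ i
    refine (wirt_dAlong Sum.inr (Sum.inl i) hU hz (hχ j)).trans ?_
    refine Finset.sum_congr rfl fun k _ => ?_
    rw [wirt_comm _ _ ((hχ j).contDiffAt (hU.mem_nhds hz))]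
  simp only [mixLoc, hw hφ, hw hψ]
  simp only [dAlong, wirt_bracketLoc hU hz hφ hψ, Finset.mul_sum, Finset.sum_mul]
  rw [Finset.sum_comm, ← Finset.sum_add_distrib]
  refine Finset.sum_congr rfl fun i _ => ?_
  simp only [← Finset.sum_sub_distrib, ← Finset.sum_add_distrib]
  refine Finset.sum_congr rfl fun k _ => ?_
  simp only [mul_add, hc k _ (tφ i), hc k _ (tψ i), mul_assoc]
  abel

lemma mixLoc_bracketLoc (hU : IsOpen U) (hz : z ∈ U)
    (hφ : ∀ i, ContDiffOn ℝ ∞ (fun w => φ w i) U) (hψ : ∀ i, ContDiffOn ℝ ∞ (fun w => ψ w i) U)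
    (j : Fin n) :
    mixLoc (bracketLoc φ ψ) χ z j
      = ∑ i, ∑ l, ((φ z i * (wirt (Sum.inl i) (fun w => ψ w l) z
            * wirt (Sum.inl l) (fun w => χ w j) z)
          + ψ z i * (wirt (Sum.inl i) (fun w => φ w l) z * wirt (Sum.inl l) (fun w => χ w j) z))
        - (χ z i * (wirt (Sum.inl i) (fun w => φ w l) z * wirt (Sum.inl l) (fun w => ψ w j) z)
          + χ z i * (wirt (Sum.inl i) (fun w => ψ w l) z * wirt (Sum.inl l) (fun w => φ w j) z)
          + χ z i * (φ z l * wirt (Sum.inl i) (wirt (Sum.inl l) (fun w => ψ w j)) z)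
          + χ z i * (ψ z l * wirt (Sum.inl i) (wirt (Sum.inl l) (fun w => φ w j)) z))) := by
  simp only [mixLoc, wirt_bracketLoc hU hz hφ hψ]
  simp only [Finset.sum_sub_distrib]
  congr 1
  · rw [Finset.sum_comm]
    simp only [bracketLoc, Finset.sum_mul, add_mul, mul_assoc]
  · simp only [Finset.mul_sum, mul_add]
    refine Finset.sum_congr rfl fun i _ => Finset.sum_congr rfl fun l _ => ?_
    abel

/-- Products of two first derivatives cancel in pairs under cyclic permutation. Terms with a second
derivative cancel because `∂ᵢ∂ₗ` is symmetric while the two undifferentiated `(0,1)`-coefficients in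
front of it anticommute. -/
lemma jacobi_bracketLoc (hU : IsOpen U) (hz : z ∈ U)
    (hφ : ∀ i, ContDiffOn ℝ ∞ (fun w => φ w i) U) (hψ : ∀ i, ContDiffOn ℝ ∞ (fun w => ψ w i) U)
    (hχ : ∀ i, ContDiffOn ℝ ∞ (fun w => χ w i) U) (tφ : ∀ i, φ z i ∈ V01 n)
    (tψ : ∀ i, ψ z i ∈ V01 n) (tχ : ∀ i, χ z i ∈ V01 n) (j : Fin n) :
    mixLoc (bracketLoc φ ψ) χ z j + mixLoc (bracketLoc ψ χ) φ z j
      + mixLoc (bracketLoc χ φ) ψ z j = 0 := by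
  have second : ∀ {α β γ : (Fin n → ℂ) → Fin n → Lam n}, (∀ i, α z i ∈ V01 n) →
      (∀ i, β z i ∈ V01 n) → (∀ i, ContDiffOn ℝ ∞ (fun w => γ w i) U) →
      ∑ i, ∑ l, α z i * (β z l * wirt (Sum.inl i) (wirt (Sum.inl l) (fun w => γ w j)) z)
        = -∑ i, ∑ l, β z i * (α z l * wirt (Sum.inl i) (wirt (Sum.inl l) (fun w => γ w j)) z) := by
    intro α β γ tα tβ hγ
    rw [Finset.sum_comm]
    simp only [← Finset.sum_neg_distrib]
    refine Finset.sum_congr rfl fun i _ => Finset.sum_congr rfl fun l _ => ?_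
    rw [wirt_comm _ _ ((hγ j).contDiffAt (hU.mem_nhds hz)), ← mul_assoc,
      V01_anticomm (tα l) (tβ i), neg_mul, mul_assoc]
  rw [mixLoc_bracketLoc hU hz hφ hψ, mixLoc_bracketLoc hU hz hψ hχ, mixLoc_bracketLoc hU hz hχ hφ]
  simp only [Finset.sum_sub_distrib, Finset.sum_add_distrib]
  rw [second tχ tφ hψ, second tχ tψ hφ, second tφ tψ hχ]
  abel

end

/-! ### The Leibniz and Jacobi identities for forms on the manifold, evaluated at points of charts
-/

section Manifold

variable {M : Type*} [TopologicalSpace M] [ChartedSpace (Fin n → ℂ) M]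

/-- A coefficient of the mixed bracket of vector-valued forms at a point of a chart, as a linear
map in the first argument. -/
def mixAt (c : atlas (Fin n → ℂ) M) {z : Fin n → ℂ} (hz : z ∈ c.1.target) (j : Fin n)
    (φ : VForm n M 1) : VForm n M 2 →ₗ[ℂ] Lam n where
  toFun σ := mixLoc (σ.val c) (φ.val c) z j
  map_add' σ τ := by
    simp only [mixLoc, VForm.add_val, Pi.add_apply, wirt_add _ (σ.diff c j hz) (τ.diff c j hz),
      ← Finset.sum_add_distrib]
    refine Finset.sum_congr rfl fun i _ => ?_
    rw [add_mul, mul_add]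
    abel
  map_smul' r σ := by
    have := fun i => wirt_clm (Sum.inl i) (LinearMap.lsmul ℂ (Lam n) r) (σ.diff c j hz)
    simp only [LinearMap.lsmul_apply] at this
    simp only [mixLoc, VForm.smul_val, Pi.smul_apply, this, RingHom.id_apply, Finset.smul_sum,
      smul_sub, smul_mul_assoc, mul_smul_comm]

lemma mixAt_zero (c : atlas (Fin n → ℂ) M) {z : Fin n → ℂ} (hz : z ∈ c.1.target) (j : Fin n) :
    mixAt c hz j 0 = 0 := by
  refine LinearMap.ext fun σ => ?_
  simp [mixAt, mixLoc, wirt_const]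

variable [IsManifold 𝓘(ℂ, Fin n → ℂ) ω M]

lemma mixLoc_congr {σ τ φ : (Fin n → ℂ) → Fin n → Lam n} {z : Fin n → ℂ} (h : σ =ᶠ[nhds z] τ)
    (j : Fin n) : mixLoc σ φ z j = mixLoc τ φ z j := by
  have h' : (fun w => σ w j) =ᶠ[nhds z] fun w => τ w j := by
    filter_upwards [h] with w hw using congrFun hw j
  simp only [mixLoc, h.self_of_nhds, wirt_congr _ h']

/-- The chart expression of the bracket is cut off outside the target; since the target is open,
this does not affect derivatives at its points. -/
lemma mixAt_bracket (c : atlas (Fin n → ℂ) M) {z : Fin n → ℂ} (hz : z ∈ c.1.target) (j : Fin n)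
    (φ ψ χ : VForm n M 1) :
    mixAt c hz j χ (bracket φ ψ) = mixLoc (bracketLoc (φ.val c) (ψ.val c)) (χ.val c) z j := by
  refine mixLoc_congr ?_ j
  filter_upwards [c.1.open_target.mem_nhds hz] with w hw using bracket_val φ ψ c hw

lemma mixAt_jacobi (c : atlas (Fin n → ℂ) M) {z : Fin n → ℂ} (hz : z ∈ c.1.target) (j : Fin n)
    (φ ψ χ : VForm n M 1) :
    mixAt c hz j χ (bracket φ ψ) + mixAt c hz j φ (bracket ψ χ) + mixAt c hz j ψ (bracket χ φ)
      = 0 := by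
  simp only [mixAt_bracket]
  exact jacobi_bracketLoc c.1.open_target hz (φ.smooth c) (ψ.smooth c) (χ.smooth c)
    (φ.mem_V01 c z) (ψ.mem_V01 c z) (χ.mem_V01 c z) j

lemma dbarV_val {q : ℕ} (φ : VForm n M q) (c : atlas (Fin n → ℂ) M) {z : Fin n → ℂ}
    (hz : z ∈ c.1.target) :
    (dbarV q φ).val c z = fun j => dAlong Sum.inr (fun w => φ.val c w j) z :=
  Set.indicator_of_mem hz fun z j => dAlong Sum.inr (fun w => φ.val c w j) z

/-- `∂̄[φ,ψ] = [∂̄φ,ψ] + [∂̄ψ,φ]`. -/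
lemma dbarV_bracket_val (c : atlas (Fin n → ℂ) M) {z : Fin n → ℂ} (hz : z ∈ c.1.target)
    (j : Fin n) (φ ψ : VForm n M 1) :
    (dbarV 2 (bracket φ ψ)).val c z j
      = mixAt c hz j ψ (dbarV 1 φ) + mixAt c hz j φ (dbarV 1 ψ) := by
  have e : ∀ φ ψ : VForm n M 1, mixAt c hz j ψ (dbarV 1 φ)
      = mixLoc (fun w i => dAlong Sum.inr (fun w => φ.val c w i) w) (ψ.val c) z j := by
    intro φ ψ
    refine mixLoc_congr ?_ j
    filter_upwards [c.1.open_target.mem_nhds hz] with w hw using dbarV_val φ c hw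
  rw [e, e, dbarV_val _ c hz, ← dbar_bracketLoc c.1.open_target hz (φ.smooth c) (ψ.smooth c)
    (φ.mem_V01 c z) (ψ.mem_V01 c z)]
  refine dAlong_congr _ ?_
  filter_upwards [c.1.open_target.mem_nhds hz] with w hw
  rw [bracket_val φ ψ c hw]

lemma bracket_zero_left (ψ : VForm n M 1) : bracket 0 ψ = 0 := by
  refine VForm.ext_target fun c z hz => ?_
  rw [bracket_val _ _ c hz]
  funext j
  simp [bracketLoc, wirt_const]

lemma bracket_zero_right (φ : VForm n M 1) : bracket φ 0 = 0 := by
  refine VForm.ext_target fun c z hz => ?_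
  rw [bracket_val _ _ c hz]
  funext j
  simp [bracketLoc, wirt_const]

/-! ### Truncated deformations -/

/-- The family `φ`, with the members outside of `1,…,N` replaced by zero. -/
def truncate (N : ℕ) (φ : ℕ → VForm n M 1) (k : ℕ) : VForm n M 1 :=
  if k ∈ Finset.Icc 1 N then φ k else 0

/-- The coefficient of order `k` of `[φ,φ]`. -/
def bracketCoeff (φ : ℕ → VForm n M 1) (k : ℕ) : VForm n M 2 :=
  ∑ x ∈ Finset.HasAntidiagonal.antidiagonal k, bracket (φ x.1) (φ x.2)

lemma truncate_eq {N k : ℕ} (φ : ℕ → VForm n M 1) (h : k ∈ Finset.Icc 1 N) :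
    truncate N φ k = φ k := if_pos h

lemma truncate_eq_zero {N k : ℕ} (φ : ℕ → VForm n M 1) (h : k ∉ Finset.Icc 1 N) :
    truncate N φ k = 0 := if_neg h

/-- Up to order `N + 1` truncation removes only the two extreme terms of the convolution: for `0 < j
< k ≤ N + 1` both `j` and `k - j` lie in `1,…,N`. In particular the obstruction is the coefficient
of order `N + 1` of the truncated family. -/
lemma bracketCoeff_truncate {N k : ℕ} (hk : k ≤ N + 1) (φ : ℕ → VForm n M 1) :
    bracketCoeff (truncate N φ) k = ∑ j ∈ Finset.Ico 1 k, bracket (φ j) (φ (k - j)) := by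
  rw [bracketCoeff, Finset.Nat.sum_antidiagonal_eq_sum_range_succ
    (fun a b => bracket (truncate N φ a) (truncate N φ b))]
  have hsub : Finset.Ico 1 k ⊆ Finset.range k.succ := fun j hj => by
    simp only [Finset.mem_Ico, Finset.mem_range] at hj ⊢; omega
  rw [← Finset.sum_subset hsub fun j hj hj' => ?_]
  · refine Finset.sum_congr rfl fun j hj => ?_
    simp only [Finset.mem_Ico] at hj
    rw [truncate_eq _ (by simp only [Finset.mem_Icc]; omega),
      truncate_eq _ (by simp only [Finset.mem_Icc]; omega)]
  · simp only [Finset.mem_Ico, Finset.mem_range] at hj hj'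
    rcases Nat.eq_zero_or_pos j with rfl | hj0
    · rw [truncate_eq_zero φ (k := 0) (by simp), bracket_zero_left]
    · rw [truncate_eq_zero φ (k := k - j) (by simp only [Finset.mem_Icc]; omega),
        bracket_zero_right]

lemma obstruction_eq (N : ℕ) (φ : ℕ → VForm n M 1) :
    obstruction N φ = bracketCoeff (truncate N φ) (N + 1) := by
  rw [bracketCoeff_truncate le_rfl]
  rfl

lemma IsDeformation.dbarV_truncate {N : ℕ} {φ : ℕ → VForm n M 1} (hφ : IsDeformation N φ) {k : ℕ}
    (hk : k ≤ N) :
    dbarV 1 (truncate N φ k) = (1 / 2 : ℂ) • bracketCoeff (truncate N φ) k := by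
  rw [bracketCoeff_truncate (by omega)]
  by_cases h : k ∈ Finset.Icc 1 N
  · rw [truncate_eq φ h, hφ k h]
  · have : k = 0 := by simp only [Finset.mem_Icc] at h; omega
    subst this
    rw [truncate_eq_zero φ h]
    simp

/-- The obstruction is `∂̄`-closed. -/
lemma IsDeformation.dbarV_obstruction {N : ℕ} {φ : ℕ → VForm n M 1} (hφ : IsDeformation N φ) :
    dbarV 2 (obstruction N φ) = 0 := by
  refine VForm.ext_target fun c z hz => ?_
  funext j
  let ev : VForm n M 3 →ₗ[ℂ] Lam n :=
    { toFun := fun β => β.val c z j, map_add' := fun _ _ => rfl, map_smul' := fun _ _ => rfl }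
  change ev (dbarV 2 (obstruction N φ)) = 0
  rw [obstruction_eq]
  set f := truncate N φ
  let g : ℕ → ℕ → ℕ → Lam n := fun x y b => mixAt c hz j (f b) (bracket (f x) (f y))
  have h1 : ∀ s ∈ Finset.HasAntidiagonal.antidiagonal (N + 1),
      mixAt c hz j (f s.2) (dbarV 1 (f s.1))
        = (1 / 2 : ℂ) • ∑ t ∈ Finset.HasAntidiagonal.antidiagonal s.1, g t.1 t.2 s.2 := by
    intro s hs
    rw [Finset.HasAntidiagonal.mem_antidiagonal] at hs
    by_cases h : s.1 ≤ N
    · rw [hφ.dbarV_truncate h, map_smul, bracketCoeff, map_sum]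
    -- The deformation equation is not available at order `N + 1`, but there the other factor is `f
    -- 0 = 0` and both sides vanish.
    · have : f s.2 = 0 := truncate_eq_zero φ (by simp only [Finset.mem_Icc]; omega)
      simp only [g, this, mixAt_zero, LinearMap.zero_apply, Finset.sum_const_zero, smul_zero]
  -- The two halves of the Leibniz rule agree after swapping the indices; each carries the factor
  -- `½` of the deformation equation, so together they give the full sum of double brackets.
  have h2 : ev (dbarV 2 (bracketCoeff f (N + 1)))
      = ∑ s ∈ Finset.HasAntidiagonal.antidiagonal (N + 1),
        ∑ t ∈ Finset.HasAntidiagonal.antidiagonal s.1, g t.1 t.2 s.2 := by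
    have e : ∀ s : ℕ × ℕ, ev (dbarV 2 (bracket (f s.1) (f s.2)))
        = mixAt c hz j (f s.2) (dbarV 1 (f s.1)) + mixAt c hz j (f s.1) (dbarV 1 (f s.2)) :=
      fun s => dbarV_bracket_val c hz j _ _
    simp only [bracketCoeff, map_sum, e]
    rw [Finset.sum_add_distrib, ← Finset.Nat.sum_antidiagonal_swap
      (f := fun s : ℕ × ℕ => mixAt c hz j (f s.1) (dbarV 1 (f s.2)))]
    simp only [Prod.fst_swap, Prod.snd_swap]
    rw [Finset.sum_congr rfl h1, ← Finset.smul_sum, ← add_smul]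
    norm_num
  have cyc : ∀ g : ℕ → ℕ → ℕ → Lam n, ∑ s ∈ Finset.HasAntidiagonal.antidiagonal (N + 1),
        ∑ t ∈ Finset.HasAntidiagonal.antidiagonal s.1, g t.1 t.2 s.2
      = ∑ s ∈ Finset.HasAntidiagonal.antidiagonal (N + 1),
        ∑ t ∈ Finset.HasAntidiagonal.antidiagonal s.1, g s.2 t.1 t.2 := by
    intro g
    rw [sum_antidiagonal_assoc, ← Finset.Nat.sum_antidiagonal_swap]
    rfl
  -- Three copies of the sum, two of them with cyclically permuted indices, add up termwise to the
  -- Jacobi identity.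
  have h3 : (3 : ℂ) • ev (dbarV 2 (bracketCoeff f (N + 1))) = 0 := by
    have e1 := cyc g
    have e2 := cyc fun x y b => g b x y
    rw [show (3 : ℂ) = 1 + 1 + 1 by norm_num, add_smul, add_smul, one_smul, h2]
    nth_rewrite 2 [e1]
    nth_rewrite 2 [e1]
    nth_rewrite 1 [e2]
    rw [← Finset.sum_add_distrib, ← Finset.sum_add_distrib]
    refine Finset.sum_eq_zero fun s _ => ?_
    rw [← Finset.sum_add_distrib, ← Finset.sum_add_distrib]
    refine Finset.sum_eq_zero fun t _ => ?_
    have := mixAt_jacobi c hz j (f t.1) (f t.2) (f s.2)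
    simp only [g]
    rw [← this]
  exact (smul_eq_zero.1 h3).resolve_left (by norm_num)

end Manifold

end Frolicher

namespace Frolicher

variable {n : ℕ}

section Manifold

variable {M : Type*} [TopologicalSpace M] [ChartedSpace (Fin n → ℂ) M]
  [IsManifold 𝓘(ℂ, Fin n → ℂ) ω M]

open PowerSeries

/-! ### The exponential of the contraction with a family -/

/-- The power series `∑ₖ i_{φₖ} tᵏ`. -/
def contrSeries (φ : ℕ → VForm n M 1) : PowerSeries (Module.End ℂ (Form n M)) :=
  mk fun k => contrForm 1 (φ k)

/-- The coefficients of the conjugation of `d` by the exponential of `∑ₖ i_{φₖ} tᵏ`. -/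
def conjCoeff (φ : ℕ → VForm n M 1) (k : ℕ) : Module.End ℂ (Form n M) :=
  (if k = 0 then dExt else 0) + lieForm (φ k)
    + contrForm 2 (dbarV 1 (φ k) - (1 / 2 : ℂ) • bracketCoeff φ k)

/-- The first commutator of `d` with the series has coefficients `L_{φₖ} + i_{∂̄φₖ}`. In the second
commutator only `L` contributes and gives `-i_{[φ,φ]ₖ}`; the third vanishes because contractions
commute. Hence `mul_expCoeff` applies, and the two contraction terms combine to `i_{∂̄φₖ -
½[φ,φ]ₖ}`. -/
lemma dExt_mul_expCoeff {φ : ℕ → VForm n M 1} (h0 : φ 0 = 0) {K k : ℕ} (hk : k ≤ K) :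
    dExt * expCoeff (K + 2) (contrSeries φ) k
      = ∑ x ∈ Finset.HasAntidiagonal.antidiagonal k,
        expCoeff (K + 2) (contrSeries φ) x.1 * conjCoeff φ x.2 := by
  let C₁ : PowerSeries (Module.End ℂ (Form n M)) :=
    mk fun k => lieForm (φ k) + contrForm 2 (dbarV 1 (φ k))
  let C₂ : PowerSeries (Module.End ℂ (Form n M)) := mk fun k => -contrForm 2 (bracketCoeff φ k)
  have hA : coeff 0 (contrSeries φ) = 0 := by
    rw [contrSeries, coeff_mk, h0, map_zero]
  have h₁ : C dExt * contrSeries φ = contrSeries φ * C dExt + C₁ := by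
    ext1 k
    rw [map_add, coeff_C_mul, coeff_mul_C, contrSeries, coeff_mk, coeff_mk, ← dExt_mul_contrForm]
    abel
  have h₂ : C₁ * contrSeries φ = contrSeries φ * C₁ + C₂ := by
    ext1 k
    rw [map_add, coeff_mul, coeff_mul, ← Finset.Nat.sum_antidiagonal_swap
      (f := fun x => coeff x.1 (contrSeries φ) * coeff x.2 C₁), coeff_mk, bracketCoeff, map_sum,
      ← Finset.sum_neg_distrib, ← Finset.sum_add_distrib]
    refine Finset.sum_congr rfl fun x _ => ?_
    simp only [C₁, contrSeries, coeff_mk, Prod.fst_swap, Prod.snd_swap]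
    rw [← lieForm_mul_contrForm, add_mul, mul_add,
      (contrForm_comm (φ x.2) (dbarV 1 (φ x.1))).eq]
    abel
  have h₃ : C₂ * contrSeries φ = contrSeries φ * C₂ := by
    ext1 k
    rw [coeff_mul, coeff_mul, ← Finset.Nat.sum_antidiagonal_swap]
    refine Finset.sum_congr rfl fun x _ => ?_
    simp only [C₂, contrSeries, coeff_mk, Prod.fst_swap, Prod.snd_swap]
    exact ((contrForm_comm (φ x.1) (bracketCoeff φ x.2)).neg_left).eq
  rw [mul_expCoeff hA h₁ h₂ h₃ hk]
  refine Finset.sum_congr rfl fun x _ => ?_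
  congr 1
  rw [map_add, map_add, coeff_smul, coeff_C, coeff_mk, coeff_mk, conjCoeff, map_sub, map_smul,
    smul_neg]
  abel

/-- Each `i_φ` with `φ` of type `(0,1)` preserves the total degree but lowers the filtration, so
only `F^0` is stable. -/
lemma expCoeff_contrSeries_mem (φ : ℕ → VForm n M 1) (K k : ℕ) {m : ℤ} {α : Form n M}
    (hα : α ∈ Fil 0 m) : expCoeff K (contrSeries φ) k α ∈ Fil 0 m := by
  let S : Subalgebra ℂ (Module.End ℂ (Form n M)) :=
    { carrier := {T | ∀ α ∈ Fil 0 m, T α ∈ Fil 0 m}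
      mul_mem' := fun hT hT' α hα => hT _ (hT' α hα)
      add_mem' := fun hT hT' α hα => add_mem (hT α hα) (hT' α hα)
      algebraMap_mem' := fun r α hα => Submodule.smul_mem _ r hα }
  refine expCoeff_mem S (fun j α hα => ?_) K k α hα
  rw [contrSeries, coeff_mk]
  have := Fil_le_Fil_zero _ _ (contrForm_mem_Fil (φ j) hα)
  rwa [Nat.cast_one, add_sub_cancel_right] at this

/-! ### Solving `(exp(-i_φ) d exp(i_φ)) a = 0` order by order -/

/-- With series notation, `d(e a) = e(D a)`. If `D a` vanishes below order `k`, the coefficient of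
order `k` of `e(D a)` is that of `D a` itself, because `e₀ = 1`. So the first nonzero error term is
exact. -/
lemma dExt_sum_exp {e D : ℕ → Module.End ℂ (Form n M)} (he : e 0 = 1) {k : ℕ}
    (hD : dExt * e k = ∑ x ∈ Finset.HasAntidiagonal.antidiagonal k, e x.1 * D x.2)
    (hD' : ∀ j < k, dExt * e j = ∑ x ∈ Finset.HasAntidiagonal.antidiagonal j, e x.1 * D x.2)
    {a : ℕ → Form n M}
    (ha : ∀ j < k, ∑ x ∈ Finset.HasAntidiagonal.antidiagonal j, D x.1 (a x.2) = 0) :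
    dExt (∑ x ∈ Finset.HasAntidiagonal.antidiagonal k, e x.1 (a x.2))
      = ∑ x ∈ Finset.HasAntidiagonal.antidiagonal k, D x.1 (a x.2) := by
  have h : ∀ x ∈ Finset.HasAntidiagonal.antidiagonal k, dExt (e x.1 (a x.2))
      = ∑ y ∈ Finset.HasAntidiagonal.antidiagonal x.1, e y.1 (D y.2 (a x.2)) := by
    intro x hx
    rw [Finset.HasAntidiagonal.mem_antidiagonal] at hx
    have hx' : dExt * e x.1
        = ∑ y ∈ Finset.HasAntidiagonal.antidiagonal x.1, e y.1 * D y.2 := by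
      rcases (show x.1 ≤ k by omega).eq_or_lt with h | h
      · rw [h]; exact hD
      · exact hD' _ h
    have := LinearMap.congr_fun hx' (a x.2)
    rwa [LinearMap.sum_apply] at this
  rw [map_sum, Finset.sum_congr rfl h,
    sum_antidiagonal_assoc k fun i j l => e i (D j (a l))]
  simp only [← map_sum]
  rw [Finset.sum_eq_single (0, k)]
  · simp [he]
  · rintro ⟨i, j⟩ hx hne
    rw [Finset.HasAntidiagonal.mem_antidiagonal] at hx
    have : j < k := by
      rcases Nat.eq_zero_or_pos i with rfl | hi
      · exact absurd (by simpa using hx) fun h : j = k => hne (by rw [h])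
      · simp only at hx; omega
    change e i (∑ x ∈ Finset.HasAntidiagonal.antidiagonal j, D x.1 (a x.2)) = 0
    rw [ha j this, map_zero]
  · intro h
    simp at h

/-- Changing `a` at index `m` leaves the orders below `m` of `D a` untouched and alters order `m`
only by `D₀ η`; this makes the successive corrections in `exists_solution` independent. -/
lemma sum_conj_single (D : ℕ → Module.End ℂ (Form n M)) {j m : ℕ} (h : j ≤ m) (η : Form n M) :
    ∑ x ∈ Finset.HasAntidiagonal.antidiagonal j, D x.1 ((Pi.single m η : ℕ → Form n M) x.2)
      = if j = m then D 0 η else 0 := by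
  split_ifs with hj
  · subst hj
    rw [Finset.sum_eq_single (0, j)]
    · simp
    · rintro ⟨i, l⟩ hx hne
      rw [Finset.HasAntidiagonal.mem_antidiagonal] at hx
      rw [Pi.single_eq_of_ne, map_zero]
      rintro rfl
      exact hne (Prod.ext (by simpa using hx) rfl)
    · intro h
      simp at h
  · refine Finset.sum_eq_zero fun x hx => ?_
    rw [Finset.HasAntidiagonal.mem_antidiagonal] at hx
    rw [Pi.single_eq_of_ne (by omega), map_zero]

/-- Induction on the order. The error at order `k + 1` lies in `F^m` because the `Dᵢ` preserve
`F^m`, and it is exact by `dExt_sum_exp`, a priori only with a primitive in `F^0`. Strictness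
replaces this by a primitive in `F^m`, which is subtracted from the coefficient of index `k + 1`. -/
lemma exists_solution {e D : ℕ → Module.End ℂ (Form n M)} (he : e 0 = 1) (h0 : D 0 = dExt)
    {N : ℕ} (hD : ∀ k ≤ N, dExt * e k
      = ∑ x ∈ Finset.HasAntidiagonal.antidiagonal k, e x.1 * D x.2)
    {m K : ℤ} (heF : ∀ k, ∀ α ∈ Fil 0 K, e k α ∈ Fil 0 K)
    (hDF : ∀ k ≤ N, ∀ α ∈ Fil m K, D k α ∈ Fil m (K + 1))
    (strict : ∀ η ∈ Fil (n := n) (M := M) 0 K, dExt η ∈ Fil m (K + 1) →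
      ∃ v ∈ Fil m K, dExt v = dExt η)
    {a₀ : Form n M} (ha₀ : a₀ ∈ Fil m K) (hd : dExt a₀ = 0) :
    ∃ a : ℕ → Form n M, a 0 = a₀ ∧ (∀ j, a j ∈ Fil m K) ∧
      ∀ j ≤ N, ∑ x ∈ Finset.HasAntidiagonal.antidiagonal j, D x.1 (a x.2) = 0 := by
  have key : ∀ k ≤ N, ∃ a : ℕ → Form n M, a 0 = a₀ ∧ (∀ j, a j ∈ Fil m K) ∧
      ∀ j ≤ k, ∑ x ∈ Finset.HasAntidiagonal.antidiagonal j, D x.1 (a x.2) = 0 := by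
    have hs : ∀ (i : ℕ) (η : Form n M), η ∈ Fil m K → ∀ j,
        (Pi.single i η : ℕ → Form n M) j ∈ Fil m K := by
      intro i η hη j
      by_cases h : j = i
      · subst h; simpa using hη
      · rw [Pi.single_eq_of_ne h]; exact zero_mem _
    intro k
    induction k with
    | zero =>
      refine fun _ => ⟨Pi.single 0 a₀, by simp, hs 0 a₀ ha₀, fun j hj => ?_⟩
      rw [sum_conj_single D hj, h0, hd, ite_self]
    | succ k ih =>
      intro hk
      obtain ⟨a, ha0, haF, ha⟩ := ih (by omega)
      have hb := dExt_sum_exp he (hD _ hk) (fun j hj => hD j (by omega))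
        fun j hj => ha j (by omega)
      have hc : ∑ x ∈ Finset.HasAntidiagonal.antidiagonal (k + 1), D x.1 (a x.2)
          ∈ Fil m (K + 1) := by
        refine Submodule.sum_mem _ fun x hx => hDF _ ?_ _ (haF _)
        rw [Finset.HasAntidiagonal.mem_antidiagonal] at hx
        omega
      obtain ⟨η, hη, e⟩ := strict _
        (Submodule.sum_mem _ fun x _ => heF x.1 _ (Fil_le_Fil_zero _ _ (haF x.2))) (hb ▸ hc)
      refine ⟨a - Pi.single (k + 1) η, by simp [ha0], fun j => sub_mem (haF j) (hs _ _ hη j),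
        fun j hj => ?_⟩
      simp only [Pi.sub_apply, map_sub, Finset.sum_sub_distrib]
      rw [sum_conj_single D hj]
      split_ifs with h
      · rw [h, h0, e, hb, sub_self]
      · rw [ha j (by omega), sub_zero]
  exact key N le_rfl

/-! ### The obstruction annihilates Dolbeault classes -/

lemma conjCoeff_truncate_of_le {N : ℕ} {φ : ℕ → VForm n M 1} (hφ : IsDeformation N φ) {k : ℕ}
    (hk : k ≤ N) :
    conjCoeff (truncate N φ) k = (if k = 0 then dExt else 0) + lieForm (truncate N φ k) := by
  rw [conjCoeff, hφ.dbarV_truncate hk, sub_self, map_zero, add_zero]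

lemma lieForm_zero : lieForm (0 : VForm n M 1) = 0 := by
  simp [lieForm]

/-- Since the truncated family vanishes at `N + 1`, only the bracket term of `conjCoeff` survives,
and it is the obstruction. -/
lemma conjCoeff_truncate_succ (N : ℕ) (φ : ℕ → VForm n M 1) :
    conjCoeff (truncate N φ) (N + 1) = -((1 / 2 : ℂ) • contrForm 2 (obstruction N φ)) := by
  rw [conjCoeff, truncate_eq_zero φ (k := N + 1) (by simp), lieForm_zero, obstruction_eq]
  simp

/-- If `d` is strict at the three relevant steps of the filtration, then the contraction of a
`∂̄`-closed form with the obstruction is `∂̄`-exact. -/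
lemma contrForm_obstruction_mem {N : ℕ} {φ : ℕ → VForm n M 1} (hφ : IsDeformation N φ) {p q : ℤ}
    (strict : ∀ m, p - 1 ≤ m → m ≤ p + 1 → ∀ l, ∀ η ∈ Fil (n := n) (M := M) l (p + q),
      dExt η ∈ Fil m (p + q + 1) → ∃ v ∈ Fil m (p + q), dExt v = dExt η)
    {α : Form n M} (hα : α ∈ Zdbar p q) :
    contrForm 2 (obstruction N φ) α ∈ Bdbar (p - 1) (q + 2) := by
  set σ := obstruction N φ
  set f := truncate N φ
  have hαF : α ∈ Fil p (p + q) := Apq_le_Fil le_rfl rfl hα.1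
  have hdα : dExt α = del α := by
    rw [dExt, LinearMap.add_apply, LinearMap.mem_ker.1 hα.2, add_zero]
  -- `dα = ∂α` already lies in `F^{p+1}`, so `α` can be corrected within `F^{p+1}` to the `d`-closed
  -- form `α - β`, without changing its leading component.
  obtain ⟨β, hβ, hdβ⟩ := strict (p + 1) (by omega) le_rfl p α hαF
    (hdα ▸ Apq_le_Fil le_rfl (by omega) (del_mem hα.1))
  have f0 : f 0 = 0 := truncate_eq_zero φ (by simp)
  have hA : coeff 0 (contrSeries f) = 0 := by rw [contrSeries, coeff_mk, f0, map_zero]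
  have hD := fun k (hk : k ≤ N + 1) => dExt_mul_expCoeff f0 hk
  have hD0 : conjCoeff f 0 = dExt := by
    rw [conjCoeff_truncate_of_le hφ (Nat.zero_le N), if_pos rfl]
    change dExt + lieForm (f 0) = _
    rw [f0, lieForm_zero, add_zero]
  have hDF : ∀ k ≤ N, ∀ α ∈ Fil p (p + q), conjCoeff f k α ∈ Fil p (p + q + 1) := by
    intro k hk α hα
    rw [conjCoeff_truncate_of_le hφ hk]
    refine add_mem ?_ (lieForm_mem_Fil _ hα)
    split_ifs
    exacts [dExt_mem_Fil hα, zero_mem _]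
  -- The series starts at `a₀ = α - β` and solves the equation up to order `N`; here strictness is
  -- used at the step `F^p`.
  obtain ⟨a, ha0, haF, ha⟩ := exists_solution (expCoeff_zero hA (N + 1 + 2)) hD0
    (fun k hk => hD k (by omega)) (fun k α hα => expCoeff_contrSeries_mem f _ k hα) hDF
    (strict p (by omega) (by omega) 0) (sub_mem hαF (Fil_mono (by omega) _ hβ))
    (by rw [map_sub, hdβ, sub_self])
  have hb := dExt_sum_exp (expCoeff_zero hA (N + 1 + 2)) (hD _ le_rfl)
    (fun j hj => hD j (by omega)) (fun j hj => ha j (by omega))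
  -- The term `D_{N+1} a₀ = -½ i_σ(α - β)` is split off; the remaining terms involve only `Dₖ` with
  -- `k ≤ N` and stay in `F^p`.
  rw [Finset.Nat.sum_antidiagonal_succ' (f := fun x : ℕ × ℕ => conjCoeff f x.1 (a x.2)),
    conjCoeff_truncate_succ, ha0] at hb
  have hγ : ∑ x ∈ Finset.HasAntidiagonal.antidiagonal N, conjCoeff f x.1 (a (x.2 + 1))
      ∈ Fil p (p + q + 1) := by
    refine Submodule.sum_mem _ fun x hx => hDF _ ?_ _ (haF _)
    rw [Finset.HasAntidiagonal.mem_antidiagonal] at hx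
    omega
  set γ := ∑ x ∈ Finset.HasAntidiagonal.antidiagonal N, conjCoeff f x.1 (a (x.2 + 1))
  -- The contraction loses one step of the filtration, and `β` lies one step higher than `α`.
  have hσβ : contrForm 2 σ β ∈ Fil p (p + q + 1) := by
    have := contrForm_mem_Fil σ hβ
    rwa [add_sub_cancel_right, show p + q + ((2 : ℕ) : ℤ) - 1 = p + q + 1 by push_cast; ring]
      at this
  have hσα : contrForm 2 σ α ∈ Apq (p - 1) (q + 2) := contrForm_mem σ hα.1
  have hσαF : contrForm 2 σ α ∈ Fil (p - 1) (p + q + 1) := Apq_le_Fil le_rfl (by ring) hσα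
  set b := ∑ x ∈ Finset.HasAntidiagonal.antidiagonal (N + 1),
    expCoeff (N + 1 + 2) (contrSeries f) x.1 (a x.2)
  have hb' : dExt b = (-(1 / 2 : ℂ)) • contrForm 2 σ α
      + ((1 / 2 : ℂ) • contrForm 2 σ β + γ) := by
    rw [hb, LinearMap.neg_apply, LinearMap.smul_apply, map_sub]
    module
  -- The third use of strictness: `db` lies in `F^{p-1}` with leading component `-½ i_σ α`, so it
  -- has a primitive there.
  obtain ⟨η, hη, hdη⟩ := strict (p - 1) le_rfl (by omega) 0 b
    (Submodule.sum_mem _ fun x _ =>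
      expCoeff_contrSeries_mem f _ _ (Fil_le_Fil_zero _ _ (haF x.2)))
    (hb' ▸ add_mem (Submodule.smul_mem _ _ hσαF) (Fil_mono (by omega) _
      (add_mem (Submodule.smul_mem _ _ hσβ) hγ)))
  obtain ⟨η₁, hη₁, η₂, hη₂, rfl⟩ := Submodule.mem_sup.1 (Fil_le_sup _ _ hη)
  rw [show p + q - (p - 1) = q + 1 by ring] at hη₁
  rw [sub_add_cancel] at hη₂
  have e : (-(1 / 2 : ℂ)) • contrForm 2 σ α - dbar η₁
      = del η₁ + dExt η₂ - ((1 / 2 : ℂ) • contrForm 2 σ β + γ) := by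
    rw [hb', map_add, dExt, LinearMap.add_apply, ← dExt] at hdη
    rw [sub_eq_sub_iff_add_eq_add, ← hdη]
    abel
  have hdel : del η₁ ∈ Fil p (p + q + 1) := Apq_le_Fil (by omega) (by ring) (del_mem hη₁)
  have hdbar := dbar_mem hη₁
  rw [show q + 1 + 1 = q + 2 by ring] at hdbar
  -- By `e`, the difference of the `(p-1,q+2)`-components `-½ i_σ α` and `∂̄η₁` also lies in `F^p`,
  -- hence it is zero.
  have hz := Submodule.disjoint_def.1 (disjoint_Apq_Fil (n := n) (M := M) (p - 1) (q + 2)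
    (p + q + 1)) _ (sub_mem (Submodule.smul_mem _ (-(1 / 2 : ℂ)) hσα) hdbar)
    (by
      rw [e, sub_add_cancel]
      exact sub_mem (add_mem hdel (dExt_mem_Fil hη₂))
        (add_mem (Submodule.smul_mem _ _ hσβ) hγ))
  -- The factor `-2` undoes the coefficient `-½` in `∂̄η₁ = -½ i_σ α`.
  refine ⟨(-2 : ℂ) • η₁, Submodule.smul_mem _ _ ?_, ?_⟩
  · rwa [show q + 2 - 1 = q + 1 by ring]
  · rw [map_smul, ← sub_eq_zero.1 hz, smul_smul]
    norm_num

end Manifold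

end Frolicher

end

/-! ### The theorem: from vanishing differentials to strictness in degree `p + q` -/

theorem theorem1p3 {n : ℕ} {M : Type*} [TopologicalSpace M] [T2Space M] [CompactSpace M]
    [ChartedSpace (Fin n → ℂ) M] [IsManifold 𝓘(ℂ, Fin n → ℂ) ω M] (p q : ℤ)
    (h₁ : ∀ r : ℤ, 1 ≤ r → Frolicher.dr n M r p q = 0)
    (h₂ : ∀ r : ℤ, 1 ≤ r → Frolicher.dr n M r (p - 1) (q + 1) = 0)
    (h₃ : ∀ r i : ℤ, 1 ≤ r → 0 ≤ i → i ≤ r - 1 → Frolicher.dr n M r (p - 2 - i) (q + 2 + i) = 0)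
    (N : ℕ) (φ : ℕ → Frolicher.VForm n M 1) (hφ : Frolicher.IsDeformation N φ) :
    ∃ h : Frolicher.obstruction N φ ∈ LinearMap.ker (Frolicher.dbarV 2),
      (Submodule.Quotient.mk ⟨Frolicher.obstruction N φ, h⟩ : Frolicher.H02T n M)
        ∈ LinearMap.ker (Frolicher.mu p q) := by
  refine ⟨LinearMap.mem_ker.2 hφ.dbarV_obstruction, LinearMap.mem_ker.2 ?_⟩
  refine Submodule.linearMap_qext _ (LinearMap.ext fun α => ?_)
  refine (Submodule.Quotient.mk_eq_zero _).2 ?_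
  refine Frolicher.contrForm_obstruction_mem hφ (fun m hm hm' l η hη hdη =>
    Frolicher.exists_dExt_eq (fun l r hl hr => ?_) hη hdη) α.2
  -- Strictness at `F^m` concerns the levels `l < m ≤ p + 1` and the differentials with `r ≥ m - l`.
  -- For `l ≤ p - 2` put `i = p - 2 - l`; since `m ≥ p - 1`, one gets `r ≥ p - 1 - l = i + 1`, which
  -- is the range of the third hypothesis.
  rcases (show l = p ∨ l = p - 1 ∨ l ≤ p - 2 by omega) with rfl | rfl | hl'
  · rw [add_sub_cancel_left]
    exact h₁ r (by omega)
  · rw [show p + q - (p - 1) = q + 1 by ring]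
    exact h₂ r (by omega)
  · have := h₃ r (p - 2 - l) (by omega) (by omega) (by omega)
    rwa [sub_sub_cancel, show q + 2 + (p - 2 - l) = p + q - l by ring] at this
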